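/- Let $\mathbb{C}_+=\{z\in\mathbb{C}:\operatorname{Re}z>0\}$. Let $\tilde\nu\neq 0$ be a positive regular Borel measure on $[0,\infty)$ (finite on compact sets) with $\sup_{r>0}\tilde\nu[0,2r)/\tilde\nu[0,r)<\infty$, let $\nu=\tilde\nu\otimes\lambda$ on $[0,\infty)\times i\mathbb{R}$ with $\lambda$ the Lebesgue measure on $i\mathbb{R}$, and let $$A^2_\nu=\Big\{F:\mathbb{C}_+\to\mathbb{C}\text{ analytic}:\ \|F\|_{A^2_\nu}^2=\sup_{\varepsilon>0}\int_{\overline{\mathbb{C}_+}}|F(z+\varepsilon)|^2\,d\nu(z)<\infty\Big\}$$ be the corresponding Zen space. Put $w(t)=2\pi\int_0^\infty e^{-2rt}\,d\tilde\nu(r)$ for $t>0$, let $L^2_w(0,\infty)$ be the space of measurable $f:(0,\infty)\to\mathbb{C}$ with $\int_0^\infty|f(t)|^2w(t)\,dt<\infty$, and assume that the Laplace transform $f\mapsto\int_0^\infty e^{-zt}f(t)\,dt$ maps $L^2_w(0,\infty)$ onto $A^2_\nu$. For $\alpha>-1$ let $\mathcal{B}^2_\alpha(\mathbb{C}_+)$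 be the weighted Bergman space of analytic $F:\mathbb{C}_+\to\mathbb{C}$ with $\|F\|_{\mathcal{B}^2_\alpha}^2=\int_{\mathbb{C}_+}(\operatorname{Re}z)^\alpha|F(z)|^2\,\frac{dz}{\pi}<\infty$, where $dz$ is the area measure. Let $h:\mathbb{C}_+\to\mathbb{C}$ and $\varphi:\mathbb{C}_+\to\mathbb{C}_+$ be holomorphic and $W_{h,\varphi}F=h\cdot(F\circ\varphi)$. Let $c=\lim_{x\to+\infty}\varphi(x)/x$, which is the coefficient of $z$ in the Nevanlinna representation of $\varphi$, and let $0<a\le c$ (in particular $c>0$, and $a=c$ is allowed). If $W_{h,\varphi}$ is bounded on $A^2_\nu$, then there exists $\alpha'>0$ such that for all $\alpha\ge\alpha'$ the operator $W_{h,\varphi}$ is bounded on $\mathcal{B}^2_\alpha(\mathbb{C}_+)$ and $$\|W_{h,\varphi}\|_{\mathcal{B}^2_\alpha(\mathbb{C}_+)}\le a^{-\frac{\alpha+1}{2}}\Big(\sup_{t>0}\frac{w(t/a)}{w(t)}\Big)^{1/2}\|W_{h,\varphi}\|_{A^2_\nu}<\infty.$$ -/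

import Mathlib

open MeasureTheory Set Filter Topology
open scoped NNReal ENNReal

noncomputable section

namespace ZenSpace

/-- The open right complex half-plane `ℂ₊`. -/
def rightHalfPlane : Set ℂ := {z | 0 < z.re}

/-- The `Δ₂`-condition `sup_{r>0} ν[0,2r) / ν[0,r) < ∞` for a measure `ν` on `[0,∞)`. In `ℝ≥0` the
set `Iio r` is the interval `[0,r)`. A quotient with denominator `0` and positive numerator
is `∞` here, so for `ν ≠ 0` the condition forces `ν[0,r) > 0` for all `r > 0`. -/
def DeltaTwo (ν : Measure ℝ≥0) : Prop :=
  (⨆ (r : ℝ≥0) (_ : 0 < r), ν (Iio (2 * r)) / ν (Iio r)) < ∞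

/-- The norm of `A²_ν`, with values in `[0,∞]`: the square root of the supremum over `ε > 0` of
`∫ |F(z+ε)|² d(ν ⊗ λ)(z)`, the integral being over the closed half-plane `[0,∞) × iℝ`. -/
def zenNorm (ν : Measure ℝ≥0) (F : ℂ → ℂ) : ℝ≥0∞ :=
  (⨆ (ε : ℝ) (_ : 0 < ε),
    ∫⁻ p : ℝ≥0 × ℝ, ‖F ⟨(p.1 : ℝ) + ε, p.2⟩‖ₑ ^ 2 ∂(ν.prod (volume : Measure ℝ))) ^ (1 / 2 : ℝ)

/-- The norm of the weighted Bergman space `B²_α(ℂ₊)`, `α > -1`, with values in `[0,∞]`: the square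
root of `∫_{ℂ₊} (re z)^α |F(z)|² dz / π`. -/
def bergmanNorm (α : ℝ) (F : ℂ → ℂ) : ℝ≥0∞ :=
  ((∫⁻ z in rightHalfPlane, ENNReal.ofReal (z.re ^ α) * ‖F z‖ₑ ^ 2) /
    ENNReal.ofReal Real.pi) ^ (1 / 2 : ℝ)

/-- Membership in the space of analytic functions on `ℂ₊` that have finite norm `N`. Functions are
represented by total functions `ℂ → ℂ`, of which only the values on `ℂ₊` matter. -/
def MemSpace (N : (ℂ → ℂ) → ℝ≥0∞) (F : ℂ → ℂ) : Prop :=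
  DifferentiableOn ℂ F rightHalfPlane ∧ N F < ∞

/-- `T` is a bounded operator from the space with norm `N` to itself. -/
def IsBoundedOn (N : (ℂ → ℂ) → ℝ≥0∞) (T : (ℂ → ℂ) → (ℂ → ℂ)) : Prop :=
  ∃ C : ℝ≥0, ∀ F, MemSpace N F → MemSpace N (T F) ∧ N (T F) ≤ C * N F

/-- The operator norm of `T` on the space with norm `N` (`∞` if `T` is not bounded). -/
def opNorm (N : (ℂ → ℂ) → ℝ≥0∞) (T : (ℂ → ℂ) → (ℂ → ℂ)) : ℝ≥0∞ :=
  sInf {C : ℝ≥0∞ | ∀ F, MemSpace N F → N (T F) ≤ C * N F}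

/-- The weighted composition operator `W_{h,φ} F = h · (F ∘ φ)`. -/
def weightedComp (h φ : ℂ → ℂ) (F : ℂ → ℂ) : ℂ → ℂ := fun z => h z * F (φ z)

/-- The weight `w(t) = 2π ∫₀^∞ e^{-2rt} dν(r)`. -/
def weight (ν : Measure ℝ≥0) (t : ℝ) : ℝ≥0∞ :=
  ENNReal.ofReal (2 * Real.pi) * ∫⁻ r : ℝ≥0, ENNReal.ofReal (Real.exp (-2 * (r : ℝ) * t)) ∂ν

/-- The Laplace transform maps `L²_w(0,∞)` onto `A²_ν`. -/
def LaplaceSurjective (ν : Measure ℝ≥0) : Prop :=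
  ∀ F : ℂ → ℂ, MemSpace (zenNorm ν) F →
    ∃ f : ℝ → ℂ, AEStronglyMeasurable f (volume.restrict (Ioi 0)) ∧
      ∫⁻ t in Ioi (0 : ℝ), ‖f t‖ₑ ^ 2 * weight ν t < ∞ ∧
      ∀ z ∈ rightHalfPlane, F z = ∫ t in Ioi (0 : ℝ), Complex.exp (-z * (t : ℂ)) * f t

end ZenSpace

end

namespace ZenSpace
open FourierTransform SchwartzMap

/-! By Plancherel in the vertical variable, the Laplace transform carries `L²_w` isometrically into
`A²_ν` (`zenNorm_laplace`), and carries `L²` with weight `v_α(t) = 2Γ(α+1)(2t)^{-α-1}` isometrically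
into `B²_α` (`bergmanNorm_laplace`). Both norms of a function in `A²_ν` can thus be read off one
density `f`.

Julia's lemma (`mul_re_le_re_of_tendsto`) gives `re φ(z) ≥ c re z ≥ a re z`. This makes `W_{h,φ}`
causal: delaying `f` by `σ` delays the density `g` of the image by at least `aσ`. So `g` on `(0,
aσ]` depends only on `f` on `(0, σ]`, up to an arbitrarily small gap, and boundedness on `A²_ν` with
constant `M` yields `∫_0^{aσ} |g|² w ≤ M² ∫_0^σ |f|² w` (`sqMeasure_Iic_le`,
`measure_Iic_le_of_forall_add`).

Such a comparison of distribution functions passes to integrals of decreasing functions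
(`lintegral_antitoneOn_le`). The doubling condition makes `t^p w(t)` increasing for large `p`
(`weight_le_rpow_mul_weight`), so `ρ = v_α / w` is decreasing once `α` is large. Inserting `ρ` turns
both sides into Bergman norms: the homogeneity of `v_α` gives `a^{-(α+1)}`, and `w(t)/w(at)` gives
the supremum. Finally, every function in `B²_α` is a pointwise limit of functions in `A²_ν` with no
larger Bergman norm, and Fatou's lemma extends the bound (`bergmanNorm_weightedComp_le`). -/

/-! ### Plancherel's theorem on `L¹ ∩ L²`. -/

theorem integral_fourier_mul_eq_flip {f g : ℝ → ℂ} (hf : Integrable f) (hg : Integrable g) :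
    ∫ ξ, 𝓕 f ξ * g ξ = ∫ x, f x * 𝓕 g x := by
  simpa using! (VectorFourier.integral_fourierIntegral_smul_eq_flip (L := innerₗ ℝ)
    Real.continuous_fourierChar continuous_inner hf hg)

/-- Both transforms have the same integral against every test function, because in both cases the
transform can be moved onto the test function, which is Schwartz. -/
theorem fourier_ae_eq_fourier_toLp {f : ℝ → ℂ} (h1 : Integrable f) (h2 : MemLp f 2) :
    𝓕 f =ᵐ[volume] (𝓕 (h2.toLp f) : Lp ℂ 2) := by
  have hc : Continuous (𝓕 f) := by
    exact VectorFourier.fourierIntegral_continuous Real.continuous_fourierChar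
      (L := innerₗ ℝ) continuous_inner h1
  refine ae_eq_of_integral_contDiff_smul_eq hc.locallyIntegrable
    ((Lp.memLp _).locallyIntegrable (by norm_num)) ?_
  intro g hg hgs
  have hgC : ContDiff ℝ ((⊤ : ℕ∞) : WithTop ℕ∞) (fun x => (g x : ℂ)) :=
    Complex.ofRealCLM.contDiff.comp hg
  have hgCs : HasCompactSupport (fun x => (g x : ℂ)) := hgs.comp_left (g := fun x : ℝ => (x : ℂ)) (by simp)
  let s : 𝓢(ℝ, ℂ) := hgCs.toSchwartzMap hgC
  have hs : ∀ x, s x = (g x : ℂ) := fun x => rfl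
  have key := congrArg (fun T => T s) (Lp.fourier_toTemperedDistribution_eq (h2.toLp f))
  simp only [TemperedDistribution.fourier_apply, Lp.toTemperedDistribution_apply, smul_eq_mul] at key
  have e1 : ∫ x, (𝓕 s) x * (h2.toLp f) x = ∫ x, f x * (𝓕 s) x := by
    refine integral_congr_ae ?_
    filter_upwards [h2.coeFn_toLp] with x hx
    rw [hx, mul_comm]
  have e2 := integral_fourier_mul_eq_flip h1 (s.integrable (μ := volume))
  rw [e1] at key
  rw [SchwartzMap.fourier_coe] at key
  rw [← e2] at key
  simp only [Complex.real_smul]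
  simp only [hs] at key
  rw [← key]
  exact integral_congr_ae (Eventually.of_forall fun x => mul_comm _ _)

/-- Plancherel's theorem for integrable square-integrable functions. -/
theorem lintegral_fourier_sq {f : ℝ → ℂ} (h1 : Integrable f) (h2 : MemLp f 2) :
    ∫⁻ ξ, ‖𝓕 f ξ‖ₑ ^ 2 = ∫⁻ x, ‖f x‖ₑ ^ 2 := by
  have key : eLpNorm (𝓕 (h2.toLp f) : Lp (α := ℝ) ℂ 2 volume) 2 volume = eLpNorm f 2 volume := by
    have := Lp.norm_fourier_eq (h2.toLp f)
    rw [Lp.norm_def, Lp.norm_def, ENNReal.toReal_eq_toReal_iff' (Lp.eLpNorm_ne_top _) (Lp.eLpNorm_ne_top _)] at this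
    rw [this]
    exact eLpNorm_congr_ae h2.coeFn_toLp
  rw [← eLpNorm_congr_ae (fourier_ae_eq_fourier_toLp h1 h2),
    eLpNorm_eq_lintegral_rpow_enorm_toReal (by norm_num) (by norm_num),
    eLpNorm_eq_lintegral_rpow_enorm_toReal (by norm_num) (by norm_num)] at key
  simp only [ENNReal.toReal_ofNat, ENNReal.rpow_ofNat] at key
  exact ENNReal.rpow_left_injective (by norm_num) key

/-! ### Consequences of the doubling condition for the weight. -/

theorem lintegral_comp_const_mul (f : ℝ → ℝ≥0∞) {c : ℝ} (hc : 0 < c) :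
    ∫⁻ y, f (c * y) = ENNReal.ofReal c⁻¹ * ∫⁻ x, f x := by
  have := (Homeomorph.mulLeft₀ c hc.ne').measurableEmbedding.lintegral_map (μ := volume) f
  simp only [Homeomorph.coe_mulLeft₀] at this
  rw [← this, Real.map_volume_mul_left hc.ne', lintegral_smul_measure, abs_of_pos (by positivity)]
  rfl

theorem measure_Iio_lt_top (ν : Measure ℝ≥0) [IsFiniteMeasureOnCompacts ν] (r : ℝ≥0) :
    ν (Iio r) < ∞ :=
  (measure_mono (Iio_subset_Iic_self.trans (Icc_bot (a := r)).symm.subset)).trans_lt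
    (isCompact_Icc (a := ⊥) (b := r)).measure_lt_top

theorem exists_deltaTwo_const {ν : Measure ℝ≥0} [IsFiniteMeasureOnCompacts ν]
    (hν : ν ≠ 0) (hΔ : DeltaTwo ν) :
    ∃ C : ℝ≥0, 1 ≤ C ∧ ∀ r : ℝ≥0, 0 < r → 0 < ν (Iio r) ∧ ν (Iio (2 * r)) ≤ C * ν (Iio r) := by
  set D := ⨆ (r : ℝ≥0) (_ : 0 < r), ν (Iio (2 * r)) / ν (Iio r) with hD
  have hle : ∀ r : ℝ≥0, 0 < r → ν (Iio (2 * r)) / ν (Iio r) ≤ D := fun r hr =>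
    le_iSup₂ (f := fun (r : ℝ≥0) (_ : 0 < r) => ν (Iio (2 * r)) / ν (Iio r)) r hr
  have hDtop : D < ∞ := hΔ
  have hfin : ∀ r : ℝ≥0, ν (Iio r) ≠ ∞ := fun r => (measure_Iio_lt_top ν r).ne
  have hpos : ∀ r : ℝ≥0, 0 < r → 0 < ν (Iio r) := by
    intro r hr
    by_contra h0
    have h0 : ν (Iio r) = 0 := by simpa using h0
    -- If `ν[0,r) = 0`, the quotient is infinite unless `ν[0,2r) = 0` as well; so nullity propagates
    -- to all `[0, 2^n r)`, and `ν` would vanish.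
    have step : ∀ n : ℕ, ν (Iio (2 ^ n * r)) = 0 := by
      intro n
      induction n with
      | zero => simpa using h0
      | succ n ih =>
        by_contra hne
        have := hle (2 ^ n * r) (by positivity)
        rw [ih, ← mul_assoc, ← pow_succ', ENNReal.div_zero hne] at this
        exact absurd (this.trans_lt hDtop) (lt_irrefl _)
    apply hν
    rw [← Measure.measure_univ_eq_zero]
    have : (univ : Set ℝ≥0) = ⋃ n : ℕ, Iio (2 ^ n * r) := by
      symm
      rw [eq_univ_iff_forall]
      intro x
      obtain ⟨n, hn⟩ := pow_unbounded_of_one_lt (x / r) (one_lt_two)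
      exact mem_iUnion.2 ⟨n, (div_lt_iff₀ hr).1 hn⟩
    rw [this]
    exact measure_iUnion_null step
  refine ⟨max 1 D.toNNReal, le_max_left _ _, fun r hr => ⟨hpos r hr, ?_⟩⟩
  have h1 := hle r hr
  rw [ENNReal.div_le_iff (hpos r hr).ne' (hfin r)] at h1
  refine h1.trans ?_
  gcongr
  rw [← ENNReal.coe_toNNReal hDtop.ne]
  exact_mod_cast le_max_right _ _

theorem ofReal_exp_neg_eq_lintegral {t : ℝ} (ht : 0 < t) (r : ℝ) :
    ENNReal.ofReal (Real.exp (-2 * r * t)) =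
      ∫⁻ s in Ioi r, ENNReal.ofReal (2 * t * Real.exp (-2 * s * t)) := by
  have hi : IntegrableOn (fun s => Real.exp ((-2 * t) * s)) (Ioi r) :=
    integrableOn_exp_mul_Ioi (by linarith) r
  have e := integral_exp_mul_Ioi (a := -2 * t) (by linarith) r
  have hfun : (fun s => 2 * t * Real.exp (-2 * s * t)) =
      fun s => 2 * t * Real.exp ((-2 * t) * s) := by ext s; ring_nf
  simp only [funext_iff] at hfun
  simp_rw [hfun]
  rw [← ofReal_integral_eq_lintegral_ofReal (hi.const_mul _)
    (Eventually.of_forall fun s => by positivity), integral_const_mul, e]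
  congr 1
  field_simp

/-- Writing the exponential as the integral of its derivative over `(r,∞)` and applying Tonelli
expresses the weight through `ν[0,s)`, the only quantity that the doubling condition controls. -/
theorem lintegral_exp_eq_distribution (ν : Measure ℝ≥0) [SFinite ν] {t : ℝ} (ht : 0 < t) :
    ∫⁻ r : ℝ≥0, ENNReal.ofReal (Real.exp (-2 * (r : ℝ) * t)) ∂ν =
      ∫⁻ s in Ioi (0 : ℝ), ENNReal.ofReal (2 * t * Real.exp (-2 * s * t)) *
        ν (Iio s.toNNReal) := by
  have h1 : ∀ r : ℝ≥0, ENNReal.ofReal (Real.exp (-2 * (r : ℝ) * t)) =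
      ∫⁻ s in Ioi (0 : ℝ), (Ioi (r : ℝ)).indicator
        (fun s => ENNReal.ofReal (2 * t * Real.exp (-2 * s * t))) s := by
    intro r
    rw [ofReal_exp_neg_eq_lintegral ht, lintegral_indicator measurableSet_Ioi,
      Measure.restrict_restrict measurableSet_Ioi,
      inter_eq_self_of_subset_left (Ioi_subset_Ioi r.coe_nonneg)]
  simp_rw [h1]
  rw [lintegral_lintegral_swap]
  · refine setLIntegral_congr_fun measurableSet_Ioi fun s hs => ?_
    have : ∀ r : ℝ≥0, (Ioi (r : ℝ)).indicator
        (fun s => ENNReal.ofReal (2 * t * Real.exp (-2 * s * t))) s =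
        (Iio s.toNNReal).indicator
          (fun _ => ENNReal.ofReal (2 * t * Real.exp (-2 * s * t))) r := by
      intro r
      simp only [indicator, mem_Ioi, mem_Iio, Real.lt_toNNReal_iff_coe_lt]
    simp_rw [this]
    rw [lintegral_indicator measurableSet_Iio, setLIntegral_const]
  · have hm : MeasurableSet {p : ℝ≥0 × ℝ | (p.1 : ℝ) < p.2} :=
      measurableSet_lt (by fun_prop) (by fun_prop)
    have : (Function.uncurry fun (r : ℝ≥0) (s : ℝ) => (Ioi (r : ℝ)).indicator
        (fun s => ENNReal.ofReal (2 * t * Real.exp (-2 * s * t))) s) =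
        {p : ℝ≥0 × ℝ | (p.1 : ℝ) < p.2}.indicator
          (fun p => ENNReal.ofReal (2 * t * Real.exp (-2 * p.2 * t))) := by
      ext ⟨r, s⟩
      simp [indicator]
    rw [this]
    exact (Measurable.indicator (by fun_prop) hm).aemeasurable

theorem weight_antitone (ν : Measure ℝ≥0) : Antitone (weight ν) := by
  intro s t hst
  unfold weight
  refine mul_le_mul_right (lintegral_mono fun r => ENNReal.ofReal_le_ofReal
    (Real.exp_le_exp.2 ?_)) _
  have := r.coe_nonneg
  nlinarith

theorem weight_half_le {ν : Measure ℝ≥0} [SFinite ν] {C : ℝ≥0}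
    (hC : ∀ r : ℝ≥0, 0 < r → ν (Iio (2 * r)) ≤ C * ν (Iio r)) {t : ℝ} (ht : 0 < t) :
    weight ν (t / 2) ≤ C * weight ν t := by
  unfold weight
  rw [mul_left_comm]
  gcongr
  rw [lintegral_exp_eq_distribution ν ht, lintegral_exp_eq_distribution ν (half_pos ht),
    ← lintegral_const_mul' _ _ ENNReal.coe_ne_top, ← lintegral_indicator measurableSet_Ioi,
    ← lintegral_indicator measurableSet_Ioi]
  set G := (Ioi (0 : ℝ)).indicator fun s => ENNReal.ofReal (2 * (t / 2) *
    Real.exp (-2 * s * (t / 2))) * ν (Iio s.toNNReal) with hG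
  -- Substituting `2s` for `s` restores the exponent `-2st`, at the price of `ν[0,2s)` in place of
  -- `ν[0,s)`.
  have h2 : ∫⁻ s, G s = ENNReal.ofReal 2 * ∫⁻ s, G (2 * s) := by
    rw [lintegral_comp_const_mul _ two_pos, ← mul_assoc, ← ENNReal.ofReal_mul (by norm_num)]
    norm_num
  rw [h2, ← lintegral_const_mul' _ _ ENNReal.ofReal_ne_top]
  refine lintegral_mono fun s => ?_
  by_cases hs : 0 < s
  · rw [hG, indicator_of_mem (by simpa using hs), indicator_of_mem (by simpa using hs),
      ← mul_assoc, ← ENNReal.ofReal_mul (by norm_num), mul_left_comm]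
    have e1 : 2 * (t / 2) * (2 * Real.exp (-2 * (2 * s) * (t / 2))) =
        2 * t * Real.exp (-2 * s * t) := by ring_nf
    rw [e1, mul_left_comm]
    refine mul_le_mul_right ?_ _
    have := hC s.toNNReal (by simpa using hs)
    rwa [Real.toNNReal_mul (by norm_num), Real.toNNReal_ofNat]
  · rw [hG, indicator_of_notMem (by simpa using hs)]
    simp

theorem weight_div_two_pow_le {ν : Measure ℝ≥0} [SFinite ν] {C : ℝ≥0}
    (hC : ∀ r : ℝ≥0, 0 < r → ν (Iio (2 * r)) ≤ C * ν (Iio r)) (n : ℕ) {t : ℝ} (ht : 0 < t) :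
    weight ν (t / 2 ^ n) ≤ C ^ n * weight ν t := by
  induction n with
  | zero => simp
  | succ n ih =>
    rw [pow_succ, ← div_div, pow_succ']
    refine (weight_half_le hC (by positivity)).trans ?_
    rw [mul_assoc]
    gcongr

theorem ofReal_exp_mul_measure_le_weight (ν : Measure ℝ≥0) (κ : ℝ≥0) {t : ℝ} (ht : 0 < t) :
    ENNReal.ofReal (2 * Real.pi * Real.exp (-2 * κ * t)) * ν (Iio κ) ≤ weight ν t := by
  unfold weight
  rw [ENNReal.ofReal_mul (by positivity), mul_assoc]
  gcongr
  rw [← setLIntegral_const]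
  refine (setLIntegral_mono (by fun_prop) fun r hr => ?_).trans (setLIntegral_le_lintegral _ _)
  refine ENNReal.ofReal_le_ofReal (Real.exp_le_exp.2 ?_)
  have : (r : ℝ) < κ := by exact_mod_cast hr
  nlinarith

theorem measure_Iio_le_pow {ν : Measure ℝ≥0} {C : ℝ≥0}
    (hC : ∀ r : ℝ≥0, 0 < r → ν (Iio (2 * r)) ≤ C * ν (Iio r)) (n : ℕ) :
    ν (Iio (2 ^ n)) ≤ C ^ n * ν (Iio 1) := by
  induction n with
  | zero => simp
  | succ n ih =>
    rw [pow_succ', pow_succ']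
    refine (hC _ (by positivity)).trans ?_
    rw [mul_assoc]
    gcongr

theorem exists_two_pow_between {s : ℝ} (hs : 0 < s) : ∃ n : ℕ, s ≤ 2 ^ n ∧ (2 : ℝ) ^ n ≤ 2 * s + 1 := by
  rcases le_or_gt s 1 with h | h
  · exact ⟨0, by simpa using h, by simp; linarith⟩
  · obtain ⟨n, h1, h2⟩ := exists_nat_pow_near h.le (one_lt_two)
    refine ⟨n + 1, h2.le, ?_⟩
    rw [pow_succ]
    linarith

theorem exists_measure_Iio_le_exp {ν : Measure ℝ≥0} {C : ℝ≥0}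
    (hC : ∀ r : ℝ≥0, 0 < r → ν (Iio (2 * r)) ≤ C * ν (Iio r)) {t : ℝ} (ht : 0 < t) :
    ∃ D : ℝ, 0 ≤ D ∧ ∀ s : ℝ, 0 < s →
      ν (Iio s.toNNReal) ≤ ENNReal.ofReal (D * Real.exp (s * t)) * ν (Iio 1) := by
  -- With `C < 2^k` and `2^n ≤ 2s+1`, the doubling constant `C^n` is at most `(2s+1)^k`, a
  -- polynomial that the exponential absorbs.
  obtain ⟨k, hk⟩ := pow_unbounded_of_one_lt (C : ℝ) one_lt_two
  refine ⟨k.factorial / (t / 2) ^ k * Real.exp (t / 2), by positivity, fun s hs => ?_⟩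
  obtain ⟨n, h1, h2⟩ := exists_two_pow_between hs
  have h3 : ν (Iio s.toNNReal) ≤ ν (Iio (2 ^ n)) := by
    refine measure_mono (Iio_subset_Iio ?_)
    rw [Real.toNNReal_le_iff_le_coe]
    exact_mod_cast h1
  refine h3.trans ((measure_Iio_le_pow hC n).trans ?_)
  gcongr
  have h4 : (C : ℝ) ^ n ≤ k.factorial / (t / 2) ^ k * Real.exp (t / 2) * Real.exp (s * t) := by
    calc (C : ℝ) ^ n ≤ (2 ^ k) ^ n := by gcongr
      _ = (2 ^ n) ^ k := by rw [← pow_mul, ← pow_mul, mul_comm]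
      _ ≤ (2 * s + 1) ^ k := by gcongr
      _ = k.factorial / (t / 2) ^ k * ((t / 2 * (2 * s + 1)) ^ k / k.factorial) := by
          rw [mul_pow]; field_simp
      _ ≤ k.factorial / (t / 2) ^ k * Real.exp (t / 2 * (2 * s + 1)) := by
          gcongr
          exact Real.pow_div_factorial_le_exp _ (by positivity) _
      _ = _ := by rw [mul_assoc, ← Real.exp_add]; ring_nf
  rw [← ENNReal.ofReal_coe_nnreal, ← ENNReal.ofReal_pow (by positivity)]
  exact ENNReal.ofReal_le_ofReal h4

theorem weight_lt_top {ν : Measure ℝ≥0} [IsFiniteMeasureOnCompacts ν] [SFinite ν] {C : ℝ≥0}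
    (hC : ∀ r : ℝ≥0, 0 < r → ν (Iio (2 * r)) ≤ C * ν (Iio r)) {t : ℝ} (ht : 0 < t) :
    weight ν t < ∞ := by
  obtain ⟨D, hD, h⟩ := exists_measure_Iio_le_exp hC ht
  unfold weight
  refine ENNReal.mul_lt_top ENNReal.ofReal_lt_top ?_
  rw [lintegral_exp_eq_distribution ν ht]
  have hle : ∫⁻ s in Ioi (0 : ℝ), ENNReal.ofReal (2 * t * Real.exp (-2 * s * t)) *
      ν (Iio s.toNNReal) ≤ ∫⁻ s in Ioi (0 : ℝ),
        ENNReal.ofReal (2 * t * D * Real.exp (-t * s)) * ν (Iio 1) := by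
    refine setLIntegral_mono (by fun_prop) fun s hs => ?_
    refine (mul_le_mul_right (h s hs) _).trans ?_
    rw [← mul_assoc, ← ENNReal.ofReal_mul (by positivity)]
    refine mul_le_mul_left (ENNReal.ofReal_le_ofReal ?_) _
    rw [show -t * s = -2 * s * t + s * t by ring, Real.exp_add]
    exact le_of_eq (by ring)
  refine hle.trans_lt ?_
  rw [lintegral_mul_const' _ _ (measure_Iio_lt_top ν 1).ne]
  refine ENNReal.mul_lt_top ?_ (measure_Iio_lt_top ν 1)
  have hi : IntegrableOn (fun s => 2 * t * D * Real.exp (-t * s)) (Ioi 0) :=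
    (integrableOn_exp_mul_Ioi (by linarith) 0).const_mul _
  exact hi.lintegral_lt_top

/-- The exponent must work for `l` arbitrarily close to `1`, where plain doubling would lose a
factor `C`. Instead the change of the weight is linearised in `l - 1`, its derivative is bounded by
two doublings, and Bernoulli's inequality gives `1 + C²(l-1) ≤ l^p`. -/
theorem weight_le_rpow_mul_weight_of_le_two {ν : Measure ℝ≥0} [SFinite ν]
    {C : ℝ≥0} (hC1 : 1 ≤ C)
    (hC : ∀ r : ℝ≥0, 0 < r → ν (Iio (2 * r)) ≤ C * ν (Iio r)) {p : ℝ} (hp : (C : ℝ) ^ 2 ≤ p)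
    {s l : ℝ} (hs : 0 < s) (hl : 1 ≤ l) (hl2 : l ≤ 2) :
    weight ν s ≤ ENNReal.ofReal (l ^ p) * weight ν (l * s) := by
  -- Pointwise with `x = 2rs`: `e^{-lx} ≥ e^{-x}(1-(l-1)x)`, and `x e^{-x} ≤ e^{-x/2} ≤ e^{-lx/4}`
  -- since `l ≤ 2`.
  have h1 : weight ν s ≤ weight ν (l * s) + ENNReal.ofReal (l - 1) * weight ν (l * s / 2 ^ 2) := by
    unfold weight
    rw [mul_left_comm, ← mul_add]
    gcongr
    rw [← lintegral_const_mul' _ _ ENNReal.ofReal_ne_top, ← lintegral_add_left (by fun_prop)]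
    refine lintegral_mono fun r => ?_
    rw [← ENNReal.ofReal_mul (by linarith), ← ENNReal.ofReal_add (by positivity)
      (mul_nonneg (by linarith) (Real.exp_pos _).le)]
    refine ENNReal.ofReal_le_ofReal ?_
    have hr := r.coe_nonneg
    set x := 2 * (r : ℝ) * s with hx
    have hx0 : 0 ≤ x := by positivity
    have e1 : -2 * (r : ℝ) * s = -x := by rw [hx]; ring
    have e2 : -2 * (r : ℝ) * (l * s) = -x + -((l - 1) * x) := by rw [hx]; ring
    have e3 : -2 * (r : ℝ) * (l * s / 2 ^ 2) = -(l * x / 4) := by rw [hx]; ring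
    rw [e1, e2, e3, Real.exp_add]
    have b1 : 1 - (l - 1) * x ≤ Real.exp (-((l - 1) * x)) := by
      have := Real.add_one_le_exp (-((l - 1) * x)); linarith
    have b2 : x * Real.exp (-x) ≤ Real.exp (-(l * x / 4)) := by
      have b3 : x / 2 + 1 ≤ Real.exp (x / 2) := Real.add_one_le_exp _
      have b4 : x / 4 + 1 ≤ Real.exp (x / 4) := Real.add_one_le_exp _
      have b5 : x ≤ Real.exp (x / 2) := by
        have : Real.exp (x / 2) = Real.exp (x / 4) * Real.exp (x / 4) := by
          rw [← Real.exp_add]; ring_nf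
        nlinarith [sq_nonneg (x / 4 - 1)]
      calc x * Real.exp (-x) ≤ Real.exp (x / 2) * Real.exp (-x) := by gcongr
        _ = Real.exp (-(x / 2)) := by rw [← Real.exp_add]; ring_nf
        _ ≤ _ := by
          apply Real.exp_le_exp.2
          nlinarith
    nlinarith [Real.exp_pos (-x), mul_le_mul_of_nonneg_left b1 (Real.exp_pos (-x)).le,
      mul_le_mul_of_nonneg_left b2 (sub_nonneg.2 hl)]
  have hls : 0 < l * s := by positivity
  refine h1.trans ?_
  calc weight ν (l * s) + ENNReal.ofReal (l - 1) * weight ν (l * s / 2 ^ 2)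
      ≤ weight ν (l * s) + ENNReal.ofReal (l - 1) * (C ^ 2 * weight ν (l * s)) := by
        gcongr
        exact weight_div_two_pow_le hC 2 hls
    _ = ENNReal.ofReal (1 + (C : ℝ) ^ 2 * (l - 1)) * weight ν (l * s) := by
        rw [ENNReal.ofReal_add (by norm_num) (mul_nonneg (by positivity) (by linarith)),
          ENNReal.ofReal_mul (by positivity), ENNReal.ofReal_pow (by positivity),
          ENNReal.ofReal_coe_nnreal, ENNReal.ofReal_one]
        ring
    _ ≤ _ := by
        gcongr
        have hp1 : (1 : ℝ) ≤ p := by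
          have : (1 : ℝ) ≤ C := by exact_mod_cast hC1
          nlinarith
        have := one_add_mul_self_le_rpow_one_add (s := l - 1) (by linarith) hp1
        rw [add_sub_cancel] at this
        nlinarith

/-- The bound `l^p` is multiplicative in `l`, so a large ratio can be split into factors at most `2`
with no loss. -/
theorem weight_le_rpow_mul_weight {ν : Measure ℝ≥0} [SFinite ν]
    {C : ℝ≥0} (hC1 : 1 ≤ C)
    (hC : ∀ r : ℝ≥0, 0 < r → ν (Iio (2 * r)) ≤ C * ν (Iio r)) {p : ℝ} (hp : (C : ℝ) ^ 2 ≤ p)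
    {s t : ℝ} (hs : 0 < s) (hst : s ≤ t) :
    weight ν s ≤ ENNReal.ofReal ((t / s) ^ p) * weight ν t := by
  have key : ∀ n : ℕ, ∀ s l : ℝ, 0 < s → 1 ≤ l → l ≤ 2 ^ n →
      weight ν s ≤ ENNReal.ofReal (l ^ p) * weight ν (l * s) := by
    intro n
    induction n with
    | zero =>
      intro s l _ h1 h2
      have : l = 1 := le_antisymm (by simpa using h2) h1
      simp [this]
    | succ n ih =>
      intro s l hs h1 h2
      rcases le_or_gt l 2 with h | h
      · exact weight_le_rpow_mul_weight_of_le_two hC1 hC hp hs h1 h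
      · refine (ih s (l / 2) hs (by linarith) (by rw [pow_succ] at h2; linarith)).trans ?_
        have := weight_le_rpow_mul_weight_of_le_two hC1 hC hp (s := l / 2 * s) (l := 2)
          (by positivity) one_le_two le_rfl
        refine (mul_le_mul_right this _).trans (le_of_eq ?_)
        rw [← mul_assoc, ← ENNReal.ofReal_mul (by positivity),
          ← Real.mul_rpow (by positivity) (by positivity)]
        ring_nf
  obtain ⟨n, hn⟩ := pow_unbounded_of_one_lt (t / s) one_lt_two
  have := key n s (t / s) hs ((one_le_div hs).2 hst) hn.le
  rwa [div_mul_cancel₀ _ hs.ne'] at this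

theorem iSup_weight_div_lt_top {ν : Measure ℝ≥0} [IsFiniteMeasureOnCompacts ν] [SFinite ν]
    {C : ℝ≥0} (hC : ∀ r : ℝ≥0, 0 < r → ν (Iio (2 * r)) ≤ C * ν (Iio r)) {a : ℝ} (ha : 0 < a) :
    ⨆ (t : ℝ) (_ : 0 < t), weight ν (t / a) / weight ν t < ∞ := by
  obtain ⟨n, hn⟩ := pow_unbounded_of_one_lt a one_lt_two
  refine lt_of_le_of_lt (b := (C : ℝ≥0∞) ^ n) (iSup₂_le fun t ht => ?_)
    (ENNReal.pow_lt_top ENNReal.coe_lt_top)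
  refine ENNReal.div_le_of_le_mul ?_
  refine le_trans (weight_antitone ν ?_) (weight_div_two_pow_le hC n ht)
  gcongr


/-! ### The Laplace transform as an isometry into `A²_ν`. -/

/-- The Laplace transform of a function on `(0,∞)`. -/
noncomputable def laplace (f : ℝ → ℂ) (z : ℂ) : ℂ :=
  ∫ t in Ioi (0 : ℝ), Complex.exp (-z * (t : ℂ)) * f t

/-- Functions on `(0,∞)` that are square integrable against every decaying exponential. -/
def ExpSqIntegrable (f : ℝ → ℂ) : Prop :=
  AEStronglyMeasurable f (volume.restrict (Ioi 0)) ∧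
    ∀ x : ℝ, 0 < x → ∫⁻ t in Ioi (0 : ℝ), ENNReal.ofReal (Real.exp (-2 * x * t)) * ‖f t‖ₑ ^ 2 < ∞

theorem enorm_exp_mul_sq (x y t : ℝ) (c : ℂ) :
    ‖Complex.exp (-(⟨x, y⟩ : ℂ) * (t : ℂ)) * c‖ₑ ^ 2 =
      ENNReal.ofReal (Real.exp (-2 * x * t)) * ‖c‖ₑ ^ 2 := by
  rw [enorm_mul, mul_pow, ← ofReal_norm (Complex.exp _), Complex.norm_exp,
    ← ENNReal.ofReal_pow (by positivity), ← Real.exp_nat_mul]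
  congr 3
  simp
  ring

theorem ExpSqIntegrable.aestronglyMeasurable_exp_mul {f : ℝ → ℂ} (hf : ExpSqIntegrable f) (z : ℂ) :
    AEStronglyMeasurable (fun t : ℝ => Complex.exp (-z * (t : ℂ)) * f t)
      (volume.restrict (Ioi 0)) :=
  (Continuous.aestronglyMeasurable (by fun_prop)).mul hf.1

theorem ExpSqIntegrable.memLp {f : ℝ → ℂ} (hf : ExpSqIntegrable f) {z : ℂ} (hz : 0 < z.re) :
    MemLp (fun t : ℝ => Complex.exp (-z * (t : ℂ)) * f t) 2 (volume.restrict (Ioi 0)) := by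
  refine ⟨hf.aestronglyMeasurable_exp_mul z, ?_⟩
  rw [eLpNorm_lt_top_iff_lintegral_rpow_enorm_lt_top (by norm_num) (by norm_num)]
  have := hf.2 z.re hz
  simp only [ENNReal.toReal_ofNat, ENNReal.rpow_ofNat]
  simp_rw [← enorm_exp_mul_sq z.re z.im] at this
  exact this

/-- Cauchy–Schwarz after splitting the kernel into two factors `e^{-zt/2}`. -/
theorem ExpSqIntegrable.integrable {f : ℝ → ℂ} (hf : ExpSqIntegrable f) {z : ℂ} (hz : 0 < z.re) :
    IntegrableOn (fun t : ℝ => Complex.exp (-z * (t : ℂ)) * f t) (Ioi 0) := by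
  have h1 : ExpSqIntegrable (fun _ => 1) := by
    refine ⟨aestronglyMeasurable_const, fun x hx => ?_⟩
    simp only [enorm_one, one_pow, mul_one]
    exact (integrableOn_exp_mul_Ioi (by linarith) 0).lintegral_lt_top
  have hz2 : 0 < (z / 2).re := by simpa using hz
  have := MemLp.integrable_mul (h1.memLp hz2) (hf.memLp hz2)
  refine this.congr (Eventually.of_forall fun t => ?_)
  simp only [Pi.mul_apply, mul_one]
  rw [← mul_assoc, ← Complex.exp_add]
  ring_nf

theorem laplace_eq_fourier (f : ℝ → ℂ) (x y : ℝ) :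
    laplace f ⟨x, y⟩ = 𝓕 ((Ioi 0).indicator fun t : ℝ => Complex.exp (-(x : ℂ) * t) * f t)
      ((2 * Real.pi)⁻¹ * y) := by
  rw [Real.fourier_real_eq_integral_exp_smul, laplace, ← integral_indicator measurableSet_Ioi]
  congr 1
  ext t
  by_cases ht : t ∈ Ioi (0 : ℝ)
  · rw [indicator_of_mem ht, indicator_of_mem ht, smul_eq_mul, ← mul_assoc, ← Complex.exp_add]
    congr 2
    have : (⟨x, y⟩ : ℂ) = x + y * Complex.I := by apply Complex.ext <;> simp
    rw [this]
    have hpi : (Real.pi : ℂ) ≠ 0 := by exact_mod_cast Real.pi_ne_zero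
    push_cast
    field_simp
    ring
  · simp [indicator_of_notMem ht]

theorem lintegral_laplace_vertical {f : ℝ → ℂ} (hf : ExpSqIntegrable f) {x : ℝ} (hx : 0 < x) :
    ∫⁻ y : ℝ, ‖laplace f ⟨x, y⟩‖ₑ ^ 2 = ENNReal.ofReal (2 * Real.pi) *
      ∫⁻ t in Ioi (0 : ℝ), ENNReal.ofReal (Real.exp (-2 * x * t)) * ‖f t‖ₑ ^ 2 := by
  have hz : 0 < (x : ℂ).re := by simpa using hx
  simp_rw [laplace_eq_fourier]
  rw [lintegral_comp_const_mul (fun s => ‖𝓕 ((Ioi 0).indicator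
    fun t : ℝ => Complex.exp (-(x : ℂ) * t) * f t) s‖ₑ ^ 2) (by positivity), inv_inv,
    lintegral_fourier_sq ((integrable_indicator_iff measurableSet_Ioi).2 (hf.integrable hz))
      ((memLp_indicator_iff_restrict measurableSet_Ioi).2 (hf.memLp hz)),
    ← lintegral_indicator measurableSet_Ioi]
  congr 2
  ext t
  by_cases ht : t ∈ Ioi (0 : ℝ)
  · rw [indicator_of_mem ht, indicator_of_mem ht]
    exact enorm_exp_mul_sq x 0 t (f t)
  · simp [indicator_of_notMem ht]

theorem ExpSqIntegrable.differentiableOn {f : ℝ → ℂ} (hf : ExpSqIntegrable f) :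
    DifferentiableOn ℂ (laplace f) rightHalfPlane := by
  intro z hz
  have hz : 0 < z.re := hz
  refine DifferentiableAt.differentiableWithinAt ?_
  -- On the ball of radius `2d` the real part stays at least `2d`; half of this decay absorbs the
  -- factor `t` of the derivative and the other half dominates.
  set d := z.re / 4 with hd
  have hd0 : 0 < d := by positivity
  have hbd : ∀ w ∈ Metric.ball z (2 * d), 2 * d ≤ w.re := by
    intro w hw
    have h1 : |w.re - z.re| < 2 * d := by
      rw [← Complex.sub_re]
      exact (Complex.abs_re_le_norm _).trans_lt (by simpa [dist_eq_norm] using hw)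
    linarith [(abs_lt.1 h1).1]
  have hint := (hf.integrable (z := (d : ℂ)) (by simpa using hd0)).norm.const_mul d⁻¹
  refine (hasDerivAt_integral_of_dominated_loc_of_deriv_le
    (F := fun z (t : ℝ) => Complex.exp (-z * (t : ℂ)) * f t)
    (F' := fun z (t : ℝ) => -(t : ℂ) * (Complex.exp (-z * (t : ℂ)) * f t))
    (Metric.ball_mem_nhds z (by positivity : 0 < 2 * d))
    (Eventually.of_forall fun w => hf.aestronglyMeasurable_exp_mul w) (hf.integrable hz)
    ((Continuous.aestronglyMeasurable (by fun_prop)).mul (hf.aestronglyMeasurable_exp_mul z))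
    ?_ hint ?_).2.differentiableAt
  · refine (ae_restrict_mem measurableSet_Ioi).mono fun t ht w hw => ?_
    have ht : 0 < t := ht
    have hw' := hbd w hw
    rw [norm_mul, norm_mul, norm_mul, Complex.norm_exp, Complex.norm_exp, norm_neg,
      Complex.norm_real, Real.norm_of_nonneg ht.le, ← mul_assoc, ← mul_assoc]
    refine mul_le_mul_of_nonneg_right ?_ (norm_nonneg _)
    have e1 : (-w * (t : ℂ)).re = -w.re * t := by simp
    have e2 : (-(d : ℂ) * (t : ℂ)).re = -d * t := by simp
    rw [e1, e2]
    calc t * Real.exp (-w.re * t) ≤ t * (Real.exp (-(d * t)) * Real.exp (-d * t)) := by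
          rw [← Real.exp_add]
          gcongr
          nlinarith
      _ = d⁻¹ * (d * t * Real.exp (-(d * t))) * Real.exp (-d * t) := by field_simp
      _ ≤ d⁻¹ * 1 * Real.exp (-d * t) := by
          gcongr
          rw [Real.exp_neg, ← div_eq_mul_inv, div_le_one (Real.exp_pos _)]
          linarith [Real.add_one_le_exp (d * t)]
      _ = _ := by rw [mul_one]
  · refine Eventually.of_forall fun t w _ => ?_
    have h1 : HasDerivAt (fun w : ℂ => -w * (t : ℂ)) (-(t : ℂ)) w := by
      simpa using (hasDerivAt_id w).neg.mul_const (t : ℂ)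
    convert! (h1.cexp.mul_const (f t)) using 1
    ring

/-- Stated for a general measure and parametrisation so that it serves both `ν` shifted by `ε` and
`x^α dx`. -/
theorem lintegral_lintegral_laplace {X : Type*} [MeasurableSpace X] (m : Measure X) [SFinite m]
    {u : X → ℝ} (hu : Measurable u) (hpos : ∀ᵐ x ∂m, 0 < u x) {f : ℝ → ℂ}
    (hf : ExpSqIntegrable f) :
    ∫⁻ x, (∫⁻ y : ℝ, ‖laplace f ⟨u x, y⟩‖ₑ ^ 2) ∂m = ∫⁻ t in Ioi (0 : ℝ), ‖f t‖ₑ ^ 2 *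
      (ENNReal.ofReal (2 * Real.pi) * ∫⁻ x, ENNReal.ofReal (Real.exp (-2 * u x * t)) ∂m) := by
  have h1 : ∫⁻ x, (∫⁻ y : ℝ, ‖laplace f ⟨u x, y⟩‖ₑ ^ 2) ∂m = ∫⁻ x, (∫⁻ t in Ioi (0 : ℝ),
      ENNReal.ofReal (2 * Real.pi) * (ENNReal.ofReal (Real.exp (-2 * u x * t)) *
        ‖f t‖ₑ ^ 2)) ∂m := by
    refine lintegral_congr_ae (hpos.mono fun x hx => ?_)
    beta_reduce
    rw [lintegral_const_mul' _ _ ENNReal.ofReal_ne_top]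
    exact lintegral_laplace_vertical hf hx
  rw [h1, lintegral_lintegral_swap]
  · refine lintegral_congr fun t => ?_
    rw [← lintegral_const_mul' _ _ ENNReal.ofReal_ne_top, ← lintegral_const_mul' _ _ (by simp)]
    exact lintegral_congr fun x => by ring
  · change AEMeasurable (fun p : X × ℝ => ENNReal.ofReal (2 * Real.pi) *
      (ENNReal.ofReal (Real.exp (-2 * u p.1 * p.2)) * ‖f p.2‖ₑ ^ 2)) _
    have hexp : Measurable fun p : X × ℝ =>
      ENNReal.ofReal (Real.exp (-2 * u p.1 * p.2)) := by fun_prop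
    exact (hexp.aemeasurable.mul (hf.1.enorm.pow_const 2).comp_snd).const_mul _

/-- Since `ν[0,x) > 0`, the weight dominates a positive multiple of `e^{-2xt}`. -/
theorem ExpSqIntegrable.of_weight {ν : Measure ℝ≥0} (hν : ∀ r : ℝ≥0, 0 < r → 0 < ν (Iio r))
    {f : ℝ → ℂ} (hf : AEStronglyMeasurable f (volume.restrict (Ioi 0)))
    (h : ∫⁻ t in Ioi (0 : ℝ), ‖f t‖ₑ ^ 2 * weight ν t < ∞) : ExpSqIntegrable f := by
  refine ⟨hf, fun x hx => ?_⟩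
  have hx' : 0 < x.toNNReal := by simpa using hx
  have hpi : ENNReal.ofReal (2 * Real.pi) ≠ 0 := by simp [Real.pi_pos]
  have hle : ∀ t ∈ Ioi (0 : ℝ), (ENNReal.ofReal (2 * Real.pi) * ν (Iio x.toNNReal)) *
      (ENNReal.ofReal (Real.exp (-2 * x * t)) * ‖f t‖ₑ ^ 2) ≤ ‖f t‖ₑ ^ 2 * weight ν t := by
    intro t ht
    have := ofReal_exp_mul_measure_le_weight ν x.toNNReal ht
    rw [Real.coe_toNNReal _ hx.le, ENNReal.ofReal_mul (by positivity)] at this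
    calc _ = ‖f t‖ₑ ^ 2 * (ENNReal.ofReal (2 * Real.pi) *
          ENNReal.ofReal (Real.exp (-2 * x * t)) * ν (Iio x.toNNReal)) := by ring
      _ ≤ _ := by gcongr
  have hc0 : ENNReal.ofReal (2 * Real.pi) * ν (Iio x.toNNReal) ≠ 0 :=
    mul_ne_zero hpi (hν _ hx').ne'
  by_contra htop
  have htop : ∫⁻ t in Ioi (0 : ℝ), ENNReal.ofReal (Real.exp (-2 * x * t)) * ‖f t‖ₑ ^ 2 = ∞ := by
    simpa using htop
  have h2 := (lintegral_const_mul_le (μ := volume.restrict (Ioi (0 : ℝ)))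
    (ENNReal.ofReal (2 * Real.pi) * ν (Iio x.toNNReal))
    (fun t => ENNReal.ofReal (Real.exp (-2 * x * t)) * ‖f t‖ₑ ^ 2)).trans
    (setLIntegral_mono' measurableSet_Ioi hle)
  rw [htop, ENNReal.mul_top hc0] at h2
  exact absurd (h2.trans_lt h) (lt_irrefl _)

theorem zenNorm_eq_iSup_lintegral_lintegral (ν : Measure ℝ≥0) [SFinite ν] {F : ℂ → ℂ}
    (hF : ContinuousOn F rightHalfPlane) :
    zenNorm ν F = (⨆ (ε : ℝ) (_ : 0 < ε),
      ∫⁻ r : ℝ≥0, (∫⁻ y : ℝ, ‖F ⟨(r : ℝ) + ε, y⟩‖ₑ ^ 2) ∂ν) ^ (1 / 2 : ℝ) := by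
  unfold zenNorm
  congr 1
  refine iSup_congr fun ε => iSup_congr fun hε => ?_
  rw [lintegral_prod]
  have hc : Continuous fun p : ℝ≥0 × ℝ => F ⟨(p.1 : ℝ) + ε, p.2⟩ := by
    refine hF.comp_continuous ?_ fun p => ?_
    · have : (fun p : ℝ≥0 × ℝ => (⟨(p.1 : ℝ) + ε, p.2⟩ : ℂ)) =
          fun p => (((p.1 : ℝ) + ε : ℝ) : ℂ) + (p.2 : ℂ) * Complex.I := by
        ext p; apply Complex.ext <;> simp
      rw [this]
      fun_prop
    · have := p.1.coe_nonneg
      change 0 < (p.1 : ℝ) + ε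
      linarith
  exact (hc.measurable.enorm.pow_const 2).aemeasurable

theorem zenNorm_laplace (ν : Measure ℝ≥0) [SFinite ν] {f : ℝ → ℂ} (hf : ExpSqIntegrable f) :
    zenNorm ν (laplace f) = (∫⁻ t in Ioi (0 : ℝ), ‖f t‖ₑ ^ 2 * weight ν t) ^ (1 / 2 : ℝ) := by
  rw [zenNorm_eq_iSup_lintegral_lintegral ν hf.differentiableOn.continuousOn]
  congr 1
  have hmain : ∀ ε : ℝ, 0 < ε → ∫⁻ r : ℝ≥0, (∫⁻ y : ℝ, ‖laplace f ⟨(r : ℝ) + ε, y⟩‖ₑ ^ 2) ∂ν =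
      ∫⁻ t in Ioi (0 : ℝ), ‖f t‖ₑ ^ 2 * weight ν t * ENNReal.ofReal (Real.exp (-2 * ε * t)) := by
    intro ε hε
    rw [lintegral_lintegral_laplace ν (u := fun r : ℝ≥0 => (r : ℝ) + ε) (by fun_prop)
      (Eventually.of_forall fun r => by have := r.coe_nonneg; linarith) hf]
    refine lintegral_congr fun t => ?_
    rw [weight, mul_assoc, mul_assoc, ← lintegral_mul_const' _ _ ENNReal.ofReal_ne_top]
    congr 3
    ext r
    rw [← ENNReal.ofReal_mul (by positivity), ← Real.exp_add]
    ring_nf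
  refine le_antisymm (iSup₂_le fun ε hε => ?_) ?_
  · rw [hmain ε hε]
    refine setLIntegral_mono' measurableSet_Ioi fun t ht => ?_
    refine mul_le_of_le_one_right' ?_
    rw [ENNReal.ofReal_le_one, Real.exp_le_one_iff]
    have : 0 < t := ht
    nlinarith [mul_pos hε this]
  -- The supremum reaches the full integral by Fatou's lemma along `ε = 1/(n+1)`.
  · have hw : Measurable (weight ν) := (weight_antitone ν).measurable
    have hlim : ∀ t : ℝ, Tendsto (fun n : ℕ => ‖f t‖ₑ ^ 2 * weight ν t *
        ENNReal.ofReal (Real.exp (-2 * (1 / ((n : ℝ) + 1)) * t))) atTop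
        (𝓝 (‖f t‖ₑ ^ 2 * weight ν t * 1)) := by
      intro t
      refine ENNReal.Tendsto.const_mul ?_ (Or.inl one_ne_zero)
      rw [← ENNReal.ofReal_one]
      refine ENNReal.tendsto_ofReal ?_
      have h0 := tendsto_one_div_add_atTop_nhds_zero_nat (𝕜 := ℝ)
      have : Tendsto (fun n : ℕ => Real.exp (-2 * (1 / ((n : ℝ) + 1)) * t)) atTop
          (𝓝 (Real.exp (-2 * 0 * t))) :=
        (Real.continuous_exp.tendsto _).comp ((h0.const_mul (-2)).mul_const t)
      simpa using this
    calc ∫⁻ t in Ioi (0 : ℝ), ‖f t‖ₑ ^ 2 * weight ν t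
        = ∫⁻ t in Ioi (0 : ℝ), liminf (fun n : ℕ => ‖f t‖ₑ ^ 2 * weight ν t *
          ENNReal.ofReal (Real.exp (-2 * (1 / ((n : ℝ) + 1)) * t))) atTop := by
          refine lintegral_congr fun t => ?_
          rw [(hlim t).liminf_eq, mul_one]
      _ ≤ liminf (fun n : ℕ => ∫⁻ t in Ioi (0 : ℝ), ‖f t‖ₑ ^ 2 * weight ν t *
          ENNReal.ofReal (Real.exp (-2 * (1 / ((n : ℝ) + 1)) * t))) atTop := by
          refine lintegral_liminf_le' fun n => ?_
          exact ((hf.1.enorm.pow_const 2).mul hw.aemeasurable).mul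
            (Measurable.aemeasurable (by fun_prop))
      _ ≤ _ := by
          refine liminf_le_of_le ⟨0, by simp⟩ fun b hb => ?_
          obtain ⟨n, hn⟩ := hb.exists
          refine hn.trans ?_
          have hε : (0 : ℝ) < 1 / ((n : ℝ) + 1) := by positivity
          rw [← hmain _ hε]
          exact le_iSup₂ (f := fun (ε : ℝ) (_ : 0 < ε) =>
            ∫⁻ r : ℝ≥0, (∫⁻ y : ℝ, ‖laplace f ⟨(r : ℝ) + ε, y⟩‖ₑ ^ 2) ∂ν) _ hε

/-! ### The Laplace transform and the Bergman norm. -/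

theorem measurableSet_rightHalfPlane : MeasurableSet rightHalfPlane :=
  measurableSet_lt measurable_const Complex.measurable_re

theorem isOpen_rightHalfPlane : IsOpen rightHalfPlane :=
  isOpen_lt continuous_const Complex.continuous_re

theorem setLIntegral_rightHalfPlane {F : ℂ → ℂ} (hF : ContinuousOn F rightHalfPlane) (α : ℝ) :
    ∫⁻ z in rightHalfPlane, ENNReal.ofReal (z.re ^ α) * ‖F z‖ₑ ^ 2 =
      ∫⁻ x in Ioi (0 : ℝ), ENNReal.ofReal (x ^ α) * ∫⁻ y : ℝ, ‖F ⟨x, y⟩‖ₑ ^ 2 := by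
  have hm : AEMeasurable (fun z : ℂ => ENNReal.ofReal (z.re ^ α) * ‖F z‖ₑ ^ 2)
      (volume.restrict rightHalfPlane) := by
    have hre : Measurable fun z : ℂ => ENNReal.ofReal (z.re ^ α) := by fun_prop
    exact hre.aemeasurable.mul
      ((hF.aestronglyMeasurable measurableSet_rightHalfPlane).enorm.pow_const 2)
  rw [← lintegral_indicator measurableSet_rightHalfPlane,
    ← (Complex.volume_preserving_equiv_real_prod.symm).lintegral_comp_emb
      Complex.measurableEquivRealProd.symm.measurableEmbedding, Measure.volume_eq_prod,
    lintegral_prod, ← lintegral_indicator measurableSet_Ioi]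
  · congr 1
    ext x
    by_cases hx : 0 < x
    · rw [indicator_of_mem (by exact hx), ← lintegral_const_mul' _ _ ENNReal.ofReal_ne_top]
      refine lintegral_congr fun y => ?_
      rw [indicator_of_mem (by exact hx)]
      rfl
    · rw [indicator_of_notMem (by exact hx)]
      refine (lintegral_congr fun y => ?_).trans lintegral_zero
      rw [indicator_of_notMem (by exact hx)]
  · exact ((aemeasurable_indicator_iff measurableSet_rightHalfPlane).2 hm).comp_quasiMeasurePreserving
      Complex.volume_preserving_equiv_real_prod.symm.quasiMeasurePreserving

/-- The weight `t ↦ 2 Γ(α+1) (2t)^{-α-1}` on `(0,∞)` that corresponds to `B²_α`. -/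
noncomputable def bergmanWeight (α t : ℝ) : ℝ≥0∞ :=
  ENNReal.ofReal (2 * Real.Gamma (α + 1) / (2 * t) ^ (α + 1))

theorem lintegral_rpow_mul_exp {α t : ℝ} (hα : -1 < α) (ht : 0 < t) :
    ENNReal.ofReal 2 * ∫⁻ x in Ioi (0 : ℝ), ENNReal.ofReal (x ^ α) *
      ENNReal.ofReal (Real.exp (-2 * x * t)) = bergmanWeight α t := by
  have h := Real.integral_rpow_mul_exp_neg_mul_Ioi (a := α + 1) (r := 2 * t) (by linarith)
    (by linarith)
  simp only [add_sub_cancel_right] at h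
  have hi : IntegrableOn (fun x : ℝ => x ^ α * Real.exp (-(2 * t * x))) (Ioi 0) := by
    -- A non-integrable function has integral `0` by convention, which contradicts the positive
    -- value of the Gamma integral.
    by_contra hcon
    rw [integral_undef hcon] at h
    have : 0 < (1 / (2 * t)) ^ (α + 1) * Real.Gamma (α + 1) :=
      mul_pos (by positivity) (Real.Gamma_pos_of_pos (by linarith))
    linarith
  have hfun : ∫⁻ x in Ioi (0 : ℝ), ENNReal.ofReal (x ^ α) *
      ENNReal.ofReal (Real.exp (-2 * x * t)) =
      ∫⁻ x in Ioi (0 : ℝ), ENNReal.ofReal (x ^ α * Real.exp (-(2 * t * x))) := by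
    refine setLIntegral_congr_fun measurableSet_Ioi fun x hx => ?_
    have hx : 0 < x := hx
    rw [← ENNReal.ofReal_mul (by positivity)]
    ring_nf
  rw [hfun, ← ofReal_integral_eq_lintegral_ofReal hi
    ((ae_restrict_mem measurableSet_Ioi).mono fun x hx => by
      have hx : 0 < x := hx
      positivity), h, ← ENNReal.ofReal_mul (by norm_num), bergmanWeight,
    Real.div_rpow zero_le_one (by positivity), Real.one_rpow]
  congr 1
  ring

theorem bergmanNorm_laplace {α : ℝ} (hα : -1 < α) {f : ℝ → ℂ} (hf : ExpSqIntegrable f) :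
    bergmanNorm α (laplace f) =
      (∫⁻ t in Ioi (0 : ℝ), ‖f t‖ₑ ^ 2 * bergmanWeight α t) ^ (1 / 2 : ℝ) := by
  unfold bergmanNorm
  congr 1
  rw [setLIntegral_rightHalfPlane hf.differentiableOn.continuousOn]
  set m : Measure ℝ := (volume.restrict (Ioi (0 : ℝ))).withDensity fun x => ENNReal.ofReal (x ^ α)
    with hm
  have hmeas : Measurable fun x : ℝ => ENNReal.ofReal (x ^ α) := by fun_prop
  have hdens : ∀ g : ℝ → ℝ≥0∞, ∫⁻ x, g x ∂m = ∫⁻ x in Ioi (0 : ℝ), ENNReal.ofReal (x ^ α) * g x :=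
    fun g => lintegral_withDensity_eq_lintegral_mul_non_measurable _ hmeas
      (Eventually.of_forall fun _ => ENNReal.ofReal_lt_top) g
  have hpos : ∀ᵐ x ∂m, 0 < x :=
    (withDensity_absolutelyContinuous _ _).ae_le (ae_restrict_mem measurableSet_Ioi)
  have key := lintegral_lintegral_laplace m (u := fun x => x) measurable_id hpos hf
  simp_rw [hdens] at key
  rw [key, ENNReal.div_eq_inv_mul, ← lintegral_const_mul' _ _ (by simp [Real.pi_pos])]
  refine setLIntegral_congr_fun measurableSet_Ioi fun t ht => ?_
  rw [← lintegral_rpow_mul_exp hα ht, mul_comm 2 Real.pi, ENNReal.ofReal_mul Real.pi_pos.le,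
    mul_left_comm, mul_assoc (ENNReal.ofReal Real.pi), ← mul_assoc _ (ENNReal.ofReal Real.pi),
    ENNReal.inv_mul_cancel (by simp [Real.pi_pos]) ENNReal.ofReal_ne_top, one_mul]

theorem zenNorm_mono (ν : Measure ℝ≥0) {F G : ℂ → ℂ}
    (h : ∀ z ∈ rightHalfPlane, ‖F z‖ ≤ ‖G z‖) : zenNorm ν F ≤ zenNorm ν G := by
  unfold zenNorm
  refine ENNReal.rpow_le_rpow (iSup₂_mono fun ε hε => lintegral_mono fun p => ?_) (by norm_num)
  have hp : (⟨(p.1 : ℝ) + ε, p.2⟩ : ℂ) ∈ rightHalfPlane := by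
    have := p.1.coe_nonneg
    change 0 < (p.1 : ℝ) + ε
    linarith
  gcongr
  exact enorm_le_iff_norm_le.2 (h _ hp)

theorem zenNorm_congr (ν : Measure ℝ≥0) {F G : ℂ → ℂ} (h : EqOn F G rightHalfPlane) :
    zenNorm ν F = zenNorm ν G :=
  le_antisymm (zenNorm_mono ν fun z hz => by rw [h hz]) (zenNorm_mono ν fun z hz => by rw [h hz])

theorem bergmanNorm_mono (α : ℝ) {F G : ℂ → ℂ}
    (h : ∀ z ∈ rightHalfPlane, ‖F z‖ ≤ ‖G z‖) : bergmanNorm α F ≤ bergmanNorm α G := by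
  unfold bergmanNorm
  refine ENNReal.rpow_le_rpow (ENNReal.div_le_div_right
    (setLIntegral_mono' measurableSet_rightHalfPlane fun z hz => ?_) _) (by norm_num)
  gcongr
  exact enorm_le_iff_norm_le.2 (h _ hz)

theorem bergmanNorm_congr (α : ℝ) {F G : ℂ → ℂ} (h : EqOn F G rightHalfPlane) :
    bergmanNorm α F = bergmanNorm α G :=
  le_antisymm (bergmanNorm_mono α fun z hz => by rw [h hz])
    (bergmanNorm_mono α fun z hz => by rw [h hz])

/-! ### Translations and the causality of the operator. -/

/-- The translate of `f` to the right by `τ`, extended by zero. -/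
noncomputable def delay (τ : ℝ) (f : ℝ → ℂ) (t : ℝ) : ℂ := (Ioi (0 : ℝ)).indicator f (t - τ)

theorem delay_of_le {τ t : ℝ} (f : ℝ → ℂ) (h : t ≤ τ) : delay τ f t = 0 :=
  indicator_of_notMem (by simpa using h) _

theorem lintegral_mul_delay {τ : ℝ} (hτ : 0 ≤ τ) (v : ℝ → ℝ≥0∞) (f : ℝ → ℂ) :
    ∫⁻ t in Ioi (0 : ℝ), v t * ‖delay τ f t‖ₑ ^ 2 =
      ∫⁻ t in Ioi (0 : ℝ), v (t + τ) * ‖f t‖ₑ ^ 2 := by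
  rw [← lintegral_indicator measurableSet_Ioi, ← lintegral_indicator measurableSet_Ioi,
    ← lintegral_sub_right_eq_self
      ((Ioi (0 : ℝ)).indicator fun t => v (t + τ) * ‖f t‖ₑ ^ 2) τ]
  refine lintegral_congr fun t => ?_
  by_cases ht : τ < t
  · rw [indicator_of_mem (by exact hτ.trans_lt ht), indicator_of_mem (by simpa using ht), delay,
      indicator_of_mem (by simpa using ht), sub_add_cancel]
  · rw [indicator_of_notMem (a := t - τ) (by simpa using ht)]
    simp only [indicator]
    split_ifs
    · simp [delay_of_le f (not_lt.1 ht)]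
    · rfl

theorem laplace_delay {τ : ℝ} (hτ : 0 ≤ τ) (f : ℝ → ℂ) (z : ℂ) :
    laplace (delay τ f) z = Complex.exp (-z * τ) * laplace f z := by
  unfold laplace
  rw [← integral_const_mul, ← integral_indicator measurableSet_Ioi,
    ← integral_indicator measurableSet_Ioi,
    ← integral_sub_right_eq_self (fun t => (Ioi (0 : ℝ)).indicator
      (fun t : ℝ => Complex.exp (-z * τ) * (Complex.exp (-z * t) * f t)) t) τ]
  congr 1
  ext t
  by_cases ht : τ < t
  · rw [indicator_of_mem (by exact hτ.trans_lt ht), indicator_of_mem (by simpa using ht), delay,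
      indicator_of_mem (by simpa using ht), ← mul_assoc, ← Complex.exp_add]
    push_cast
    ring_nf
  · rw [indicator_of_notMem (a := t - τ) (by simpa using ht)]
    simp only [indicator]
    split_ifs
    · simp [delay_of_le f (not_lt.1 ht)]
    · rfl

theorem ExpSqIntegrable.delay {f : ℝ → ℂ} (hf : ExpSqIntegrable f) {τ : ℝ} (hτ : 0 ≤ τ) :
    ExpSqIntegrable (delay τ f) := by
  refine ⟨?_, fun x hx => ?_⟩
  · have h1 : AEStronglyMeasurable ((Ioi (0 : ℝ)).indicator f) volume :=
      (aestronglyMeasurable_indicator_iff measurableSet_Ioi).2 hf.1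
    exact (h1.comp_measurePreserving (measurePreserving_sub_right volume τ)).restrict
  · rw [lintegral_mul_delay hτ]
    refine lt_of_le_of_lt (setLIntegral_mono' measurableSet_Ioi fun t ht => ?_) (hf.2 x hx)
    have ht : 0 < t := ht
    gcongr ?_ * _
    refine ENNReal.ofReal_le_ofReal (Real.exp_le_exp.2 ?_)
    nlinarith [mul_nonneg hx.le hτ]

theorem ExpSqIntegrable.sub {f g : ℝ → ℂ} (hf : ExpSqIntegrable f) (hg : ExpSqIntegrable g) :
    ExpSqIntegrable (f - g) := by
  refine ⟨hf.1.sub hg.1, fun x hx => ?_⟩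
  have hz : 0 < (⟨x, 0⟩ : ℂ).re := hx
  have h := ((hf.memLp hz).sub (hg.memLp hz)).2
  rw [eLpNorm_lt_top_iff_lintegral_rpow_enorm_lt_top (by norm_num) (by norm_num)] at h
  simp only [ENNReal.toReal_ofNat, ENNReal.rpow_ofNat, Pi.sub_apply, ← mul_sub,
    enorm_exp_mul_sq] at h
  exact h

theorem ExpSqIntegrable.laplace_sub {f g : ℝ → ℂ} (hf : ExpSqIntegrable f)
    (hg : ExpSqIntegrable g) {z : ℂ} (hz : z ∈ rightHalfPlane) :
    laplace (f - g) z = laplace f z - laplace g z := by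
  unfold laplace
  rw [← integral_sub (hf.integrable hz) (hg.integrable hz)]
  simp only [Pi.sub_apply, mul_sub]

theorem ExpSqIntegrable.indicator {f : ℝ → ℂ} (hf : ExpSqIntegrable f) {s : Set ℝ}
    (hs : MeasurableSet s) : ExpSqIntegrable (s.indicator f) := by
  refine ⟨hf.1.indicator hs, fun x hx => lt_of_le_of_lt (lintegral_mono fun t => ?_) (hf.2 x hx)⟩
  gcongr
  by_cases ht : t ∈ s <;> simp [ht]

/-- The measure `|f|² w` on `(0,∞)`. -/
noncomputable def sqMeasure (ν : Measure ℝ≥0) (f : ℝ → ℂ) : Measure ℝ :=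
  (volume.restrict (Ioi (0 : ℝ))).withDensity fun t => ‖f t‖ₑ ^ 2 * weight ν t

theorem measurable_weight (ν : Measure ℝ≥0) : Measurable (weight ν) :=
  (weight_antitone ν).measurable

theorem sqMeasure_apply (ν : Measure ℝ≥0) (f : ℝ → ℂ) {s : Set ℝ} (hs : MeasurableSet s) :
    sqMeasure ν f s = ∫⁻ t in Ioi (0 : ℝ), ‖s.indicator f t‖ₑ ^ 2 * weight ν t := by
  rw [sqMeasure, withDensity_apply _ hs, ← lintegral_indicator hs]
  refine lintegral_congr fun t => ?_
  by_cases ht : t ∈ s <;> simp [ht]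

theorem exists_two_pow_mul_sub_le {σ δ : ℝ} (hσ : 0 ≤ σ) (hδ : 0 < δ) :
    ∃ n : ℕ, ∀ t, σ + δ < t → t / 2 ^ n ≤ t - σ := by
  obtain ⟨n, hn⟩ := pow_unbounded_of_one_lt ((σ + δ) / δ) one_lt_two
  refine ⟨n, fun t ht => ?_⟩
  have h2 : (0 : ℝ) < 2 ^ n := by positivity
  rw [div_lt_iff₀ hδ] at hn
  rw [div_le_iff₀ h2]
  nlinarith [mul_nonneg hσ hδ.le, mul_nonneg hσ (sub_nonneg.2 ht.le)]

/-- Truncating `f` away from `[0, σ + δ]` leaves a function that is the translate by `σ` of a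
function in `L²_w`. -/
theorem exists_delay_eq_indicator {ν : Measure ℝ≥0} [SFinite ν] {C : ℝ≥0}
    (hpos : ∀ r : ℝ≥0, 0 < r → 0 < ν (Iio r))
    (hC : ∀ r : ℝ≥0, 0 < r → ν (Iio (2 * r)) ≤ C * ν (Iio r)) {σ δ : ℝ} (hσ : 0 ≤ σ) (hδ : 0 < δ)
    {f : ℝ → ℂ} (hf : AEStronglyMeasurable f (volume.restrict (Ioi 0)))
    (hfw : ∫⁻ t in Ioi (0 : ℝ), ‖f t‖ₑ ^ 2 * weight ν t < ∞) :
    ∃ k : ℝ → ℂ, ExpSqIntegrable k ∧ ∫⁻ t in Ioi (0 : ℝ), ‖k t‖ₑ ^ 2 * weight ν t < ∞ ∧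
      delay σ k = (Ioi (σ + δ)).indicator f := by
  set f₁ := (Ioi (σ + δ)).indicator f with hf₁
  have hd : delay σ (fun t => f₁ (t + σ)) = f₁ := by
    ext t
    by_cases ht : σ < t
    · rw [delay, indicator_of_mem (by simpa using ht), sub_add_cancel]
    · rw [delay_of_le _ (not_lt.1 ht), hf₁, indicator_of_notMem]
      simp only [mem_Ioi, not_lt]
      linarith
  have hw : ∫⁻ t in Ioi (0 : ℝ), ‖f₁ (t + σ)‖ₑ ^ 2 * weight ν t < ∞ := by
    -- The weight may blow up at `0`, so shifting back by `σ` is harmless only away from `σ`: the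
    -- gap `δ` gives `w(t-σ) ≤ w(t/2^n) ≤ C^n w(t)`.
    obtain ⟨n, hn⟩ := exists_two_pow_mul_sub_le hσ hδ
    have h1 := lintegral_mul_delay hσ (fun t => weight ν (t - σ)) (fun t => f₁ (t + σ))
    simp only [hd, add_sub_cancel_right] at h1
    simp_rw [mul_comm _ (weight ν _)]
    rw [← h1]
    refine lt_of_le_of_lt (b := C ^ n * ∫⁻ t in Ioi (0 : ℝ), ‖f t‖ₑ ^ 2 * weight ν t) ?_
      (ENNReal.mul_lt_top (ENNReal.pow_lt_top ENNReal.coe_lt_top) hfw)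
    rw [← lintegral_const_mul' _ _ (by simp)]
    refine setLIntegral_mono' measurableSet_Ioi fun t ht => ?_
    by_cases htt : σ + δ < t
    · rw [hf₁, indicator_of_mem (by exact htt), mul_left_comm, mul_comm]
      gcongr
      exact (weight_antitone ν (hn t htt)).trans (weight_div_two_pow_le hC n ht)
    · rw [hf₁, indicator_of_notMem (by exact htt)]
      simp
  refine ⟨fun t => f₁ (t + σ), ExpSqIntegrable.of_weight hpos ?_ hw, hw, hd⟩
  have h1 : AEStronglyMeasurable ((Ioi (0 : ℝ)).indicator f) volume :=
    (aestronglyMeasurable_indicator_iff measurableSet_Ioi).2 hf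
  have h2 : f₁ = (Ioi (σ + δ)).indicator ((Ioi (0 : ℝ)).indicator f) := by
    rw [indicator_indicator, inter_eq_left.2 (Ioi_subset_Ioi (by linarith))]
  rw [h2]
  exact ((h1.indicator measurableSet_Ioi).comp_measurePreserving
    (measurePreserving_add_right volume σ)).restrict

theorem MemSpace.laplace {ν : Measure ℝ≥0} [SFinite ν] {f : ℝ → ℂ} (hf : ExpSqIntegrable f)
    (hw : ∫⁻ t in Ioi (0 : ℝ), ‖f t‖ₑ ^ 2 * weight ν t < ∞) :
    MemSpace (zenNorm ν) (laplace f) :=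
  ⟨hf.differentiableOn, by
    rw [zenNorm_laplace ν hf]
    exact ENNReal.rpow_lt_top_of_nonneg (by norm_num) hw.ne⟩

/-- Composition with `φ` turns the delay factor `e^{-σz}` into `e^{-σφ(z)}`, which is `e^{-aσz}`
times a function of modulus at most `1`. So the part of `f` beyond `σ + δ` contributes nothing to
`g` on `(0, aσ]`, and only the truncation of `f` enters the bound. -/
theorem sqMeasure_Iic_le {ν : Measure ℝ≥0} [SFinite ν] {C : ℝ≥0}
    (hpos : ∀ r : ℝ≥0, 0 < r → 0 < ν (Iio r))
    (hC : ∀ r : ℝ≥0, 0 < r → ν (Iio (2 * r)) ≤ C * ν (Iio r)) (hL : LaplaceSurjective ν)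
    {h φ : ℂ → ℂ} (hφ : DifferentiableOn ℂ φ rightHalfPlane)
    (hmaps : MapsTo φ rightHalfPlane rightHalfPlane) {a : ℝ} (ha : 0 < a)
    (hre : ∀ z ∈ rightHalfPlane, a * z.re ≤ (φ z).re) {M : ℝ≥0∞}
    (hM : ∀ F, MemSpace (zenNorm ν) F → MemSpace (zenNorm ν) (weightedComp h φ F) ∧
      zenNorm ν (weightedComp h φ F) ≤ M * zenNorm ν F)
    {f g : ℝ → ℂ} (hf : AEStronglyMeasurable f (volume.restrict (Ioi 0)))
    (hfw : ∫⁻ t in Ioi (0 : ℝ), ‖f t‖ₑ ^ 2 * weight ν t < ∞)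
    (hg : ExpSqIntegrable g)
    (hfg : EqOn (weightedComp h φ (laplace f)) (laplace g) rightHalfPlane)
    {σ δ : ℝ} (hσ : 0 ≤ σ) (hδ : 0 < δ) :
    sqMeasure ν g (Iic (a * σ)) ≤ M ^ 2 * sqMeasure ν f (Iic (σ + δ)) := by
  have hfE := ExpSqIntegrable.of_weight hpos hf hfw
  obtain ⟨k, hkE, hkw, hk⟩ := exists_delay_eq_indicator hpos hC hσ hδ hf hfw
  have hWk := hM _ (MemSpace.laplace hkE hkw)
  -- The image of the delayed `k` with `e^{-aσz}` divided out. It still lies in `A²_ν`, so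
  -- surjectivity provides a density `k'`, and the image itself is the transform of `k'` delayed by
  -- `aσ`.
  set K' : ℂ → ℂ := fun z => Complex.exp (-(σ * (φ z - a * z))) *
    weightedComp h φ (laplace k) z with hK'
  have hK'mem : MemSpace (zenNorm ν) K' := by
    refine ⟨?_, (zenNorm_mono ν fun z hz => ?_).trans_lt hWk.1.2⟩
    · refine DifferentiableOn.mul ?_ hWk.1.1
      exact ((((hφ.sub (differentiableOn_id.const_mul _)).const_mul _).neg)).cexp
    · rw [hK', norm_mul, Complex.norm_exp]
      refine mul_le_of_le_one_left (norm_nonneg _) (Real.exp_le_one_iff.2 ?_)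
      have := hre z hz
      simp
      nlinarith
  obtain ⟨k', hk'm, hk'w, hk'⟩ := hL K' hK'mem
  have hk'E := ExpSqIntegrable.of_weight hpos hk'm hk'w
  have haσ : 0 ≤ a * σ := by positivity
  set f₀ := (Iic (σ + δ)).indicator f with hf₀
  have hf₀E : ExpSqIntegrable f₀ := hfE.indicator measurableSet_Iic
  have hf₀eq : f₀ = f - delay σ k := by
    rw [hk, hf₀, ← compl_Ioi, indicator_compl]
  have hf₀w : ∫⁻ t in Ioi (0 : ℝ), ‖f₀ t‖ₑ ^ 2 * weight ν t < ∞ := by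
    refine lt_of_le_of_lt (lintegral_mono fun t => ?_) hfw
    gcongr
    by_cases ht : t ∈ Iic (σ + δ)
    · simp [hf₀, ht]
    · rw [hf₀, indicator_of_notMem ht]; simp
  have key := (hM _ (MemSpace.laplace hf₀E hf₀w)).2
  have heq : EqOn (weightedComp h φ (laplace f₀)) (laplace (g - delay (a * σ) k'))
      rightHalfPlane := by
    intro z hz
    rw [hg.laplace_sub (hk'E.delay haσ) hz, laplace_delay haσ, ← hfg hz, weightedComp,
      weightedComp, hf₀eq, hfE.laplace_sub (hkE.delay hσ) (hmaps hz), laplace_delay hσ]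
    have e1 : laplace k' z = K' z := (hk' z hz).symm
    rw [e1, hK']
    simp only [weightedComp]
    rw [← mul_assoc (Complex.exp _) (Complex.exp _), ← Complex.exp_add]
    have e2 : -z * ((a * σ : ℝ) : ℂ) + -(σ * (φ z - a * z)) = -φ z * σ := by
      push_cast; ring
    rw [e2]
    ring
  rw [zenNorm_congr ν heq, zenNorm_laplace ν (hg.sub (hk'E.delay haσ)), zenNorm_laplace ν hf₀E]
    at key
  have key2 := ENNReal.rpow_le_rpow key (z := 2) (by norm_num)
  rw [ENNReal.mul_rpow_of_nonneg _ _ (by norm_num), ← ENNReal.rpow_mul, ← ENNReal.rpow_mul] at key2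
  norm_num at key2
  rw [sqMeasure_apply ν f measurableSet_Iic, sqMeasure_apply ν g measurableSet_Iic]
  -- The delayed `k'` vanishes on `(0, aσ]`, where the difference is therefore `g`.
  refine le_trans (lintegral_mono fun t => ?_) key2
  gcongr
  by_cases ht : t ≤ a * σ
  · rw [indicator_of_mem (by exact ht), delay_of_le _ ht, sub_zero]
  · rw [indicator_of_notMem (by exact ht)]
    simp

/-! ### From distribution functions to Bergman norms. -/

theorem isFiniteMeasure_sqMeasure {ν : Measure ℝ≥0} {f : ℝ → ℂ}
    (hfw : ∫⁻ t in Ioi (0 : ℝ), ‖f t‖ₑ ^ 2 * weight ν t < ∞) : IsFiniteMeasure (sqMeasure ν f) :=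
  isFiniteMeasure_withDensity hfw.ne

theorem sqMeasure_absolutelyContinuous (ν : Measure ℝ≥0) (f : ℝ → ℂ) :
    sqMeasure ν f ≪ volume.restrict (Ioi 0) := withDensity_absolutelyContinuous _ _

theorem ae_sqMeasure_pos (ν : Measure ℝ≥0) (f : ℝ → ℂ) : ∀ᵐ t ∂(sqMeasure ν f), 0 < t :=
  (sqMeasure_absolutelyContinuous ν f).ae_le (ae_restrict_mem measurableSet_Ioi)

theorem sqMeasure_Iio (ν : Measure ℝ≥0) (f : ℝ → ℂ) (s : ℝ) :
    sqMeasure ν f (Iio s) = sqMeasure ν f (Iic s) :=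
  measure_congr (((sqMeasure_absolutelyContinuous ν f).trans
    Measure.restrict_le_self.absolutelyContinuous).ae_le Iio_ae_eq_Iic)

theorem measure_Iic_le_of_forall_add {μ : Measure ℝ} [IsFiniteMeasure μ] {σ : ℝ} {A M : ℝ≥0∞}
    (hM : M ≠ ∞) (h : ∀ δ : ℝ, 0 < δ → A ≤ M * μ (Iic (σ + δ))) : A ≤ M * μ (Iic σ) := by
  have hI : ⋂ n : ℕ, Iic (σ + 1 / ((n : ℝ) + 1)) = Iic σ := by
    ext x
    simp only [mem_iInter, mem_Iic]
    refine ⟨fun hx => ?_, fun hx n => hx.trans (le_add_of_nonneg_right (by positivity))⟩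
    refine ge_of_tendsto' (f := fun n : ℕ => σ + 1 / ((n : ℝ) + 1)) (x := atTop) ?_ hx
    simpa using tendsto_one_div_add_atTop_nhds_zero_nat.const_add σ
  have hanti : Antitone fun n : ℕ => Iic (σ + 1 / ((n : ℝ) + 1)) := by
    intro m n hmn
    refine Iic_subset_Iic.2 ?_
    gcongr
  have ht := tendsto_measure_iInter_atTop (μ := μ)
    (fun n : ℕ => (measurableSet_Iic (a := σ + 1 / ((n : ℝ) + 1))).nullMeasurableSet) hanti
    ⟨0, measure_ne_top _ _⟩
  rw [hI] at ht
  exact ge_of_tendsto' (ENNReal.Tendsto.const_mul ht (Or.inr hM))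
    fun n => h _ (by positivity)

/-- Comparison of integrals of a decreasing function from comparison of distribution functions. -/
theorem lintegral_antitoneOn_le {μ₁ μ₂ : Measure ℝ} [IsFiniteMeasure μ₂]
    (h₁ : ∀ᵐ t ∂μ₁, 0 < t) (h₂ : ∀ᵐ t ∂μ₂, 0 < t)
    (hatom : ∀ s, μ₂ (Iio s) = μ₂ (Iic s)) {a : ℝ} (ha : 0 < a) {M : ℝ≥0∞} (hM : M ≠ ∞)
    (h : ∀ σ : ℝ, 0 ≤ σ → μ₁ (Iic (a * σ)) ≤ M * μ₂ (Iic σ))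
    {ρ : ℝ → ℝ} (hρm : Measurable ρ) (hρ0 : ∀ t, 0 ≤ ρ t) (hρ : AntitoneOn ρ (Ioi 0)) :
    ∫⁻ t, ENNReal.ofReal (ρ t) ∂μ₁ ≤ M * ∫⁻ t, ENNReal.ofReal (ρ (a * t)) ∂μ₂ := by
  rw [lintegral_eq_lintegral_meas_lt μ₁ (Eventually.of_forall hρ0) hρm.aemeasurable,
    lintegral_eq_lintegral_meas_lt (f := fun t => ρ (a * t)) μ₂ (Eventually.of_forall fun t => hρ0 _)
      (by fun_prop), ← lintegral_const_mul' _ _ hM]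
  refine lintegral_mono fun y => ?_
  -- By the layer-cake formula it suffices to compare superlevel sets, which are initial intervals
  -- of `(0,∞)`. Whether the endpoint belongs to them is unknown, so one side uses the closed
  -- interval and the other the open one; `hatom` reconciles the two.
  set I : Set ℝ := {t | 0 < t ∧ y < ρ t} with hI
  have e₁ : μ₁ {t | y < ρ t} ≤ μ₁ I :=
    measure_mono_ae (h₁.mono fun t ht hy => ⟨ht, hy⟩)
  by_cases hne : I.Nonempty
  · by_cases hb : BddAbove I
    · obtain ⟨t₀, ht₀⟩ := hne
      have hs0 : 0 < sSup I := ht₀.1.trans_le (le_csSup hb ht₀)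
      have hsub : I ⊆ Iic (a * (sSup I / a)) := fun t ht => by
        rw [mul_div_cancel₀ _ ha.ne']; exact le_csSup hb ht
      refine e₁.trans ((measure_mono hsub).trans ((h _ (by positivity)).trans ?_))
      refine mul_le_mul_right ?_ _
      rw [← hatom]
      refine measure_mono_ae (h₂.mono fun t ht htlt => ?_)
      have htlt : t < sSup I / a := htlt
      obtain ⟨u, hu, htu⟩ := exists_lt_of_lt_csSup ⟨t₀, ht₀⟩
        (show a * t < sSup I by rwa [lt_div_iff₀' ha] at htlt)
      exact hu.2.trans_le (hρ (mul_pos ha ht) hu.1 htu.le)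
    -- An unbounded superlevel set is all of `(0,∞)`; total masses are then compared by letting the
    -- endpoint tend to infinity.
    · have hall : ∀ t, 0 < t → y < ρ t := by
        intro t ht
        obtain ⟨u, hu, htu⟩ := not_bddAbove_iff.1 hb t
        exact hu.2.trans_le (hρ ht hu.1 htu.le)
      have huniv : μ₁ univ ≤ M * μ₂ univ := by
        refine le_of_tendsto (tendsto_measure_Iic_atTop μ₁) ?_
        filter_upwards [eventually_ge_atTop 0] with s hs
        have := h (s / a) (by positivity)
        rw [mul_div_cancel₀ _ ha.ne'] at this
        refine this.trans ?_
        gcongr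
        exact subset_univ _
      refine (measure_mono (subset_univ _)).trans (huniv.trans ?_)
      refine mul_le_mul_right ?_ _
      exact measure_mono_ae (h₂.mono fun t ht _ => hall _ (mul_pos ha ht))
  · rw [not_nonempty_iff_eq_empty.1 hne, measure_empty] at e₁
    exact e₁.trans zero_le

theorem lintegral_sqMeasure {ν : Measure ℝ≥0} {f : ℝ → ℂ}
    (hf : AEStronglyMeasurable f (volume.restrict (Ioi 0))) {r : ℝ → ℝ≥0∞} (hr : Measurable r) :
    ∫⁻ t, r t ∂(sqMeasure ν f) = ∫⁻ t in Ioi (0 : ℝ), ‖f t‖ₑ ^ 2 * weight ν t * r t :=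
  lintegral_withDensity_eq_lintegral_mul₀
    ((hf.enorm.pow_const 2).mul (measurable_weight ν).aemeasurable) hr.aemeasurable

theorem bergmanWeight_ne_top (α t : ℝ) : bergmanWeight α t ≠ ∞ := ENNReal.ofReal_ne_top

theorem bergmanWeight_mul {α : ℝ} {a t : ℝ} (ha : 0 < a) (ht : 0 < t) :
    bergmanWeight α (a * t) = ENNReal.ofReal (a ^ (-(α + 1))) * bergmanWeight α t := by
  unfold bergmanWeight
  rw [← ENNReal.ofReal_mul (by positivity), mul_left_comm, Real.mul_rpow ha.le (by positivity),
    Real.rpow_neg ha.le]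
  congr 1
  field_simp

theorem measurable_bergmanWeight (α : ℝ) : Measurable (bergmanWeight α) := by
  unfold bergmanWeight
  fun_prop

/-- The quotient of the weights of `B²_α` and `A²_ν`. -/
noncomputable def weightQuotient (ν : Measure ℝ≥0) (α t : ℝ) : ℝ :=
  (bergmanWeight α t / weight ν t).toReal

theorem measurable_weightQuotient (ν : Measure ℝ≥0) (α : ℝ) : Measurable (weightQuotient ν α) :=
  ((measurable_bergmanWeight α).div (measurable_weight ν)).ennreal_toReal

theorem ofReal_weightQuotient {ν : Measure ℝ≥0} {t : ℝ} (h0 : weight ν t ≠ 0) (α : ℝ) :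
    ENNReal.ofReal (weightQuotient ν α t) = bergmanWeight α t / weight ν t :=
  ENNReal.ofReal_toReal (ENNReal.div_ne_top (bergmanWeight_ne_top _ _) h0)

theorem antitoneOn_weightQuotient {ν : Measure ℝ≥0} (h0 : ∀ t, 0 < t → weight ν t ≠ 0) {α : ℝ}
    (htop : ∀ t, 0 < t → weight ν t ≠ ∞)
    (hα : ∀ s t, 0 < s → s ≤ t → weight ν s ≤ ENNReal.ofReal ((t / s) ^ (α + 1)) * weight ν t) :
    AntitoneOn (weightQuotient ν α) (Ioi 0) := by
  intro s hs t ht hst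
  have hs : 0 < s := hs
  have ht : 0 < t := ht
  refine ENNReal.toReal_mono (ENNReal.div_ne_top (bergmanWeight_ne_top _ _) (h0 s hs)) ?_
  have e : bergmanWeight α s = ENNReal.ofReal ((t / s) ^ (α + 1)) * bergmanWeight α t := by
    have := bergmanWeight_mul (α := α) (a := s / t) (div_pos hs ht) ht
    rw [div_mul_cancel₀ _ ht.ne', Real.rpow_neg (by positivity), ← Real.inv_rpow (by positivity),
      inv_div] at this
    exact this
  rw [ENNReal.div_le_iff (h0 t ht) (htop t ht), e, ENNReal.div_eq_inv_mul]
  calc bergmanWeight α t = (weight ν s)⁻¹ * weight ν s * bergmanWeight α t := by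
        rw [ENNReal.inv_mul_cancel (h0 s hs) (htop s hs), one_mul]
    _ ≤ (weight ν s)⁻¹ * (ENNReal.ofReal ((t / s) ^ (α + 1)) * weight ν t) *
          bergmanWeight α t := by
        gcongr
        exact hα s t hs hst
    _ = _ := by ring

/-- The Bergman norm of `F` may be infinite here: the inequality is in `[0,∞]`, so the density
argument needs no intersection of the two spaces. -/
theorem bergmanNorm_weightedComp_laplace_le {ν : Measure ℝ≥0} [SFinite ν] {C : ℝ≥0}
    (hpos : ∀ r : ℝ≥0, 0 < r → 0 < ν (Iio r))
    (hC : ∀ r : ℝ≥0, 0 < r → ν (Iio (2 * r)) ≤ C * ν (Iio r)) (hL : LaplaceSurjective ν)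
    (h0 : ∀ t, 0 < t → weight ν t ≠ 0) (htop : ∀ t, 0 < t → weight ν t ≠ ∞)
    {h φ : ℂ → ℂ} (hφ : DifferentiableOn ℂ φ rightHalfPlane)
    (hmaps : MapsTo φ rightHalfPlane rightHalfPlane) {a : ℝ} (ha : 0 < a)
    (hre : ∀ z ∈ rightHalfPlane, a * z.re ≤ (φ z).re) {M : ℝ≥0∞} (hMtop : M ≠ ∞)
    (hM : ∀ F, MemSpace (zenNorm ν) F → MemSpace (zenNorm ν) (weightedComp h φ F) ∧
      zenNorm ν (weightedComp h φ F) ≤ M * zenNorm ν F)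
    {α : ℝ} (hα1 : -1 < α)
    (hα : ∀ s t, 0 < s → s ≤ t → weight ν s ≤ ENNReal.ofReal ((t / s) ^ (α + 1)) * weight ν t)
    {F : ℂ → ℂ} (hF : MemSpace (zenNorm ν) F) :
    bergmanNorm α (weightedComp h φ F) ≤ ENNReal.ofReal (a ^ (-(α + 1) / 2)) *
      (⨆ (t : ℝ) (_ : 0 < t), weight ν (t / a) / weight ν t) ^ (1 / 2 : ℝ) * M *
      bergmanNorm α F := by
  set S := ⨆ (t : ℝ) (_ : 0 < t), weight ν (t / a) / weight ν t with hS
  obtain ⟨f, hfm, hfw, hf⟩ := hL F hF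
  obtain ⟨g, hgm, hgw, hg⟩ := hL _ (hM F hF).1
  have hfE := ExpSqIntegrable.of_weight hpos hfm hfw
  have hgE := ExpSqIntegrable.of_weight hpos hgm hgw
  have hf' : EqOn F (laplace f) rightHalfPlane := hf
  have hg' : EqOn (weightedComp h φ F) (laplace g) rightHalfPlane := hg
  have hfg : EqOn (weightedComp h φ (laplace f)) (laplace g) rightHalfPlane := fun z hz => by
    rw [← hg' hz, weightedComp, weightedComp, hf' (hmaps hz)]
  have := isFiniteMeasure_sqMeasure hfw
  have hM2 : M ^ 2 ≠ ∞ := ENNReal.pow_ne_top hMtop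
  have hmain := lintegral_antitoneOn_le (ae_sqMeasure_pos ν g) (ae_sqMeasure_pos ν f)
    (sqMeasure_Iio ν f) ha hM2
    (fun σ hσ => measure_Iic_le_of_forall_add hM2 fun δ hδ =>
      sqMeasure_Iic_le hpos hC hL hφ hmaps ha hre hM hfm hfw hgE hfg hσ hδ)
    (measurable_weightQuotient ν α) (fun _ => ENNReal.toReal_nonneg)
    (antitoneOn_weightQuotient h0 htop hα)
  have hqm := (measurable_weightQuotient ν α).ennreal_ofReal
  rw [lintegral_sqMeasure hgm hqm,
    lintegral_sqMeasure (r := fun t => ENNReal.ofReal (weightQuotient ν α (a * t))) hfm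
      (hqm.comp (measurable_const_mul a))] at hmain
  have hle : ∫⁻ t in Ioi (0 : ℝ), ‖g t‖ₑ ^ 2 * bergmanWeight α t ≤
      M ^ 2 * (ENNReal.ofReal (a ^ (-(α + 1))) * S *
        ∫⁻ t in Ioi (0 : ℝ), ‖f t‖ₑ ^ 2 * bergmanWeight α t) := by
    refine le_trans (le_of_eq ?_) (hmain.trans (mul_le_mul_right ?_ _))
    · refine setLIntegral_congr_fun measurableSet_Ioi fun t ht => ?_
      rw [ofReal_weightQuotient (h0 t ht), mul_assoc,
        ENNReal.mul_div_cancel (h0 t ht) (htop t ht)]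
    · refine le_trans (setLIntegral_mono' measurableSet_Ioi fun t ht => ?_)
        (lintegral_const_mul'' _ ((hfm.enorm.pow_const 2).mul
          (measurable_bergmanWeight α).aemeasurable)).le
      have hat : 0 < a * t := mul_pos ha ht
      rw [ofReal_weightQuotient (h0 _ hat), bergmanWeight_mul ha ht]
      -- This is the quotient of the supremum evaluated at `at`.
      have hSt : weight ν t / weight ν (a * t) ≤ S := by
        have := le_iSup₂ (f := fun (t : ℝ) (_ : 0 < t) => weight ν (t / a) / weight ν t) (a * t) hat
        rwa [mul_div_cancel_left₀ _ ha.ne'] at this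
      calc _ = ‖f t‖ₑ ^ 2 * (ENNReal.ofReal (a ^ (-(α + 1))) * bergmanWeight α t) *
            (weight ν t / weight ν (a * t)) := by
              rw [div_eq_mul_inv, div_eq_mul_inv]; ring
        _ ≤ ‖f t‖ₑ ^ 2 * (ENNReal.ofReal (a ^ (-(α + 1))) * bergmanWeight α t) * S := by gcongr
        _ = _ := by simp only [Pi.mul_apply]; ring
  rw [bergmanNorm_congr α hg', bergmanNorm_congr α hf', bergmanNorm_laplace hα1 hgE,
    bergmanNorm_laplace hα1 hfE]
  refine (ENNReal.rpow_le_rpow hle (by norm_num)).trans (le_of_eq ?_)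
  rw [ENNReal.mul_rpow_of_nonneg _ _ (by norm_num), ENNReal.mul_rpow_of_nonneg _ _ (by norm_num),
    ENNReal.mul_rpow_of_nonneg _ _ (by norm_num), ← ENNReal.rpow_natCast, ← ENNReal.rpow_mul,
    ENNReal.ofReal_rpow_of_pos (by positivity), ← Real.rpow_mul ha.le]
  norm_num
  rw [show (-1 + -α) * (1 / 2) = (-1 + -α) / 2 by ring]
  ring

/-! ### Schwarz–Pick and Julia's lemma in the half-plane. -/

theorem normSq_add_conj_sub_normSq_sub (u v : ℂ) :
    Complex.normSq (u + (starRingEnd ℂ) v) - Complex.normSq (u - v) = 4 * u.re * v.re := by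
  simp [Complex.normSq_apply]
  ring

theorem add_conj_ne_zero {u v : ℂ} (hu : 0 < u.re) (hv : 0 < v.re) :
    u + (starRingEnd ℂ) v ≠ 0 := by
  intro h
  have := congrArg Complex.re h
  simp at this
  linarith

theorem re_cayley_pos {x : ℝ} (hx : 0 < x) {ζ : ℂ} (hζ : ‖ζ‖ < 1) :
    0 < (x * (1 + ζ) / (1 - ζ)).re := by
  have hne : (1 : ℂ) - ζ ≠ 0 := by
    intro h
    rw [← sub_eq_zero.1 h] at hζ
    simp at hζ
  have hn : Complex.normSq ζ < 1 := by
    rw [Complex.normSq_eq_norm_sq]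
    nlinarith [norm_nonneg ζ]
  have hpos := Complex.normSq_pos.2 hne
  rw [Complex.div_re, ← add_div]
  refine div_pos ?_ hpos
  rw [Complex.normSq_apply] at hn
  simp
  nlinarith

/-- The Schwarz–Pick inequality on the right half-plane, at a point of the real axis. -/
theorem re_mul_normSq_le {φ : ℂ → ℂ} (hφ : DifferentiableOn ℂ φ rightHalfPlane)
    (hmaps : MapsTo φ rightHalfPlane rightHalfPlane) {x : ℝ} (hx : 0 < x) {z : ℂ}
    (hz : z ∈ rightHalfPlane) :
    x * z.re * Complex.normSq (φ z + (starRingEnd ℂ) (φ x)) ≤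
      (φ z).re * (φ x).re * Complex.normSq (z + x) := by
  have hxm : (x : ℂ) ∈ rightHalfPlane := by simpa [rightHalfPlane] using hx
  have hb : 0 < (φ x).re := hmaps hxm
  have hzre : 0 < z.re := hz
  -- `q` maps the disc to the half-plane with `q 0 = x`; following `φ ∘ q` by the Cayley map that
  -- sends `φ x` to `0` gives a self-map `ψ` to which Schwarz's lemma applies.
  set q : ℂ → ℂ := fun ζ => x * (1 + ζ) / (1 - ζ) with hq
  have hqm : MapsTo q (Metric.ball 0 1) rightHalfPlane := fun ζ hζ =>
    re_cayley_pos hx (by simpa using hζ)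
  have hqd : DifferentiableOn ℂ q (Metric.ball 0 1) := by
    refine DifferentiableOn.div (by fun_prop) (by fun_prop) fun ζ hζ h => ?_
    rw [← sub_eq_zero.1 h] at hζ
    simp at hζ
  set ψ : ℂ → ℂ := fun ζ => (φ (q ζ) - φ x) / (φ (q ζ) + (starRingEnd ℂ) (φ x)) with hψ
  have hφq : DifferentiableOn ℂ (fun ζ => φ (q ζ)) (Metric.ball 0 1) := hφ.comp hqd hqm
  have hψd : DifferentiableOn ℂ ψ (Metric.ball 0 1) :=
    (hφq.sub_const _).div (hφq.add_const _) fun ζ hζ =>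
      add_conj_ne_zero (hmaps (hqm hζ)) hb
  have hψm : MapsTo ψ (Metric.ball 0 1) (Metric.closedBall 0 1) := by
    intro ζ hζ
    have h1 : 0 < (φ (q ζ)).re := hmaps (hqm hζ)
    rw [mem_closedBall_zero_iff, hψ, norm_div, div_le_one
      (norm_pos_iff.2 (add_conj_ne_zero h1 hb)), ← sq_le_sq₀ (norm_nonneg _) (norm_nonneg _),
      ← Complex.normSq_eq_norm_sq, ← Complex.normSq_eq_norm_sq]
    have := normSq_add_conj_sub_normSq_sub (φ (q ζ)) (φ x)
    nlinarith [mul_pos h1 hb]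
  have hψ0 : ψ 0 = 0 := by simp [hψ, hq]
  have hzx : z + x ≠ 0 := by
    have := add_conj_ne_zero hzre (v := x) (by simpa using hx)
    simpa using this
  have hnx := normSq_add_conj_sub_normSq_sub z x
  rw [Complex.conj_ofReal, Complex.ofReal_re] at hnx
  have hζ : ‖(z - x) / (z + x)‖ < 1 := by
    rw [norm_div, div_lt_one (norm_pos_iff.2 hzx), ← sq_lt_sq₀ (norm_nonneg _) (norm_nonneg _),
      ← Complex.normSq_eq_norm_sq, ← Complex.normSq_eq_norm_sq]
    nlinarith [mul_pos hzre hx]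
  have key := Complex.norm_le_norm_of_mapsTo_ball hψd hψm hψ0 hζ
  have hqz : q ((z - x) / (z + x)) = z := by
    have hx0 : (x : ℂ) ≠ 0 := by exact_mod_cast hx.ne'
    have e1 : 1 + (z - x) / (z + x) = 2 * z / (z + x) := by field_simp; ring
    have e2 : 1 - (z - x) / (z + x) = 2 * x / (z + x) := by field_simp; ring
    rw [hq]
    simp only
    rw [e1, e2]
    field_simp
  have hA := add_conj_ne_zero (hmaps hz) hb
  simp only [hψ] at key
  rw [hqz, norm_div, norm_div, div_le_div_iff₀ (norm_pos_iff.2 hA) (norm_pos_iff.2 hzx),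
    ← sq_le_sq₀ (by positivity) (by positivity), mul_pow, mul_pow,
    ← Complex.normSq_eq_norm_sq, ← Complex.normSq_eq_norm_sq, ← Complex.normSq_eq_norm_sq,
    ← Complex.normSq_eq_norm_sq] at key
  have hn := normSq_add_conj_sub_normSq_sub (φ z) (φ x)
  have e1 : Complex.normSq (φ z - φ x) =
      Complex.normSq (φ z + (starRingEnd ℂ) (φ x)) - 4 * (φ z).re * (φ x).re := by linarith
  have e2 : Complex.normSq (z - x) = Complex.normSq (z + x) - 4 * z.re * x := by linarith
  rw [e1, e2] at key
  nlinarith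

/-- Julia's lemma at infinity for the right half-plane. -/
theorem mul_re_le_re_of_tendsto {φ : ℂ → ℂ} (hφ : DifferentiableOn ℂ φ rightHalfPlane)
    (hmaps : MapsTo φ rightHalfPlane rightHalfPlane) {c : ℝ} (hc0 : 0 < c)
    (hc : Tendsto (fun x : ℝ => φ (x : ℂ) / (x : ℂ)) atTop (𝓝 (c : ℂ))) {z : ℂ}
    (hz : z ∈ rightHalfPlane) : c * z.re ≤ (φ z).re := by
  have hinv : ∀ u : ℂ, Tendsto (fun x : ℝ => u / (x : ℂ)) atTop (𝓝 0) := by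
    intro u
    have h1 : Tendsto (fun x : ℝ => ((x⁻¹ : ℝ) : ℂ)) atTop (𝓝 ((0 : ℝ) : ℂ)) :=
      (Complex.continuous_ofReal.tendsto _).comp tendsto_inv_atTop_zero
    simpa [div_eq_mul_inv] using h1.const_mul u
  have hL : Tendsto (fun x : ℝ => z.re * Complex.normSq (φ z / x + (starRingEnd ℂ) (φ x / x)))
      atTop (𝓝 (z.re * Complex.normSq (0 + (starRingEnd ℂ) c))) :=
    ((Complex.continuous_normSq.tendsto _).comp ((hinv _).add
      ((Complex.continuous_conj.tendsto _).comp hc))).const_mul _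
  have hR : Tendsto (fun x : ℝ => (φ z).re * (φ x / x).re * Complex.normSq (z / x + 1))
      atTop (𝓝 ((φ z).re * (c : ℂ).re * Complex.normSq (0 + 1))) :=
    (((Complex.continuous_re.tendsto _).comp hc).const_mul _).mul
      ((Complex.continuous_normSq.tendsto _).comp ((hinv z).add_const 1))
  -- Schwarz–Pick at `x`, divided by `x³`, becomes `c² re z ≤ c re φ(z)` in the limit `x → ∞`.
  have hle := le_of_tendsto_of_tendsto hL hR (by
    filter_upwards [eventually_gt_atTop 0] with x hx
    have h1 := re_mul_normSq_le hφ hmaps hx hz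
    have hx0 : (x : ℂ) ≠ 0 := by exact_mod_cast hx.ne'
    have e1 : φ z / x + (starRingEnd ℂ) (φ x / x) = (φ z + (starRingEnd ℂ) (φ x)) / x := by
      rw [map_div₀, Complex.conj_ofReal, add_div]
    have e2 : z / x + 1 = (z + x) / x := by field_simp
    rw [e1, e2, Complex.normSq_div, Complex.normSq_div, Complex.normSq_ofReal, Complex.div_ofReal_re]
    rw [← mul_le_mul_iff_of_pos_left (show 0 < x * (x * x) by positivity)]
    calc _ = x * z.re * Complex.normSq (φ z + (starRingEnd ℂ) (φ x)) := by field_simp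
      _ ≤ _ := h1
      _ = _ := by field_simp)
  simp [Complex.normSq_ofReal] at hle
  nlinarith

/-! ### Approximation of `B²_α` functions by `A²_ν` functions. -/

/-- The mean value property of the analytic function `F²`. -/
theorem ofReal_mul_enorm_le_lintegral_circle {F : ℂ → ℂ} {c : ℂ} {r : ℝ} (hr : 0 < r)
    (hF : DifferentiableOn ℂ F (Metric.closedBall c r)) :
    ENNReal.ofReal (2 * Real.pi) * ‖F c‖ₑ ^ 2 ≤
      ∫⁻ θ in Ioo (-Real.pi) Real.pi, ‖F (circleMap c r θ)‖ₑ ^ 2 := by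
  have hd : DiffContOnCl ℂ (fun z => F z ^ 2) (Metric.ball c |r|) := by
    rw [abs_of_pos hr]
    refine DifferentiableOn.diffContOnCl ?_
    rw [closure_ball c hr.ne']
    exact hF.pow 2
  have h1 := hd.circleAverage
  have hper : Function.Periodic (fun θ => F (circleMap c r θ) ^ 2) (2 * Real.pi) := fun θ => by
    simp only [periodic_circleMap c r θ]
  rw [Real.circleAverage] at h1
  have h2 := hper.intervalIntegral_add_eq 0 (-Real.pi)
  rw [zero_add, show -Real.pi + 2 * Real.pi = Real.pi by ring] at h2
  rw [h2, intervalIntegral.integral_of_le (by linarith [Real.pi_pos]), integral_Ioc_eq_integral_Ioo,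
    inv_smul_eq_iff₀ (by positivity)] at h1
  have h3 := congrArg (fun z : ℂ => ‖z‖ₑ) h1
  simp only [enorm_smul, enorm_pow] at h3
  rw [Real.enorm_of_nonneg (by positivity)] at h3
  rw [← h3]
  refine (enorm_integral_le_lintegral_enorm _).trans (le_of_eq ?_)
  simp only [enorm_pow]

/-- In polar coordinates only the annulus `R/2 < r < R` is kept, where the Jacobian is at least
`R/2`; the sharp constant is not needed. -/
theorem mul_enorm_sq_le_setLIntegral_ball {F : ℂ → ℂ} {c : ℂ} {R : ℝ} (hR : 0 < R)
    (hF : DifferentiableOn ℂ F (Metric.ball c R)) :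
    ENNReal.ofReal (R / 2) * (ENNReal.ofReal (2 * Real.pi) * ‖F c‖ₑ ^ 2) * ENNReal.ofReal (R / 2) ≤
      ∫⁻ z in Metric.ball c R, ‖F z‖ₑ ^ 2 := by
  classical
  set G : ℂ → ℝ≥0∞ := (Metric.ball c R).indicator fun z => ‖F z‖ₑ ^ 2 with hG
  have hGm : Measurable G := by
    have : Measurable ((Metric.ball c R).piecewise (fun z => ‖F z‖ₑ ^ 2) fun _ => 0) :=
      ContinuousOn.measurable_piecewise
        ((ENNReal.continuous_pow 2).comp_continuousOn hF.continuousOn.enorm)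
        continuousOn_const Metric.isOpen_ball.measurableSet
    rw [hG, ← piecewise_eq_indicator]
    exact this
  rw [← lintegral_indicator Metric.isOpen_ball.measurableSet, ← lintegral_add_left_eq_self _ c,
    ← Complex.lintegral_comp_polarCoord_symm, polarCoord_target, Measure.volume_eq_prod,
    ← Measure.prod_restrict]
  have hpol : Measurable fun p : ℝ × ℝ => Complex.polarCoord.symm p := by
    simp only [Complex.polarCoord_symm_apply]
    fun_prop
  rw [lintegral_prod _ (by
    simp only [smul_eq_mul]
    have := hGm.comp (hpol.const_add c)
    exact ((by fun_prop : Measurable fun p : ℝ × ℝ => ENNReal.ofReal p.1).mul this).aemeasurable)]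
  calc _ = ∫⁻ r in Ioo (R / 2) R, ENNReal.ofReal (R / 2) *
        (ENNReal.ofReal (2 * Real.pi) * ‖F c‖ₑ ^ 2) := by
        rw [setLIntegral_const, Real.volume_Ioo]
        congr 2
        ring
    _ ≤ ∫⁻ r in Ioo (R / 2) R, ∫⁻ θ in Ioo (-Real.pi) Real.pi,
        ENNReal.ofReal r • G (c + Complex.polarCoord.symm (r, θ)) := by
        refine setLIntegral_mono' measurableSet_Ioo fun r hr => ?_
        have hr0 : 0 < r := by linarith [hr.1]
        simp only [smul_eq_mul]
        rw [lintegral_const_mul' _ _ ENNReal.ofReal_ne_top]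
        refine mul_le_mul' (ENNReal.ofReal_le_ofReal hr.1.le) ?_
        refine (ofReal_mul_enorm_le_lintegral_circle hr0
          (hF.mono (Metric.closedBall_subset_ball hr.2))).trans (le_of_eq ?_)
        refine lintegral_congr fun θ => ?_
        have e : c + Complex.polarCoord.symm (r, θ) = circleMap c r θ := by
          rw [Complex.polarCoord_symm_apply, circleMap, Complex.exp_mul_I]
          push_cast
          rfl
        rw [e, hG, indicator_of_mem]
        rw [Metric.mem_ball, dist_eq_norm, circleMap_sub_center, norm_circleMap_zero,
          abs_of_pos hr0]
        exact hr.2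
    _ ≤ _ := lintegral_mono_set fun r hr => by
        have : R / 2 < r := hr.1
        exact show 0 < r by linarith

theorem exists_norm_le_of_bergmanNorm_lt_top {α : ℝ} (hα : 0 ≤ α) {F : ℂ → ℂ}
    (hF : MemSpace (bergmanNorm α) F) {η : ℝ} (hη : 0 < η) :
    ∃ B : ℝ, ∀ z : ℂ, η ≤ z.re → ‖F z‖ ≤ B := by
  set X := ∫⁻ z in rightHalfPlane, ENNReal.ofReal (z.re ^ α) * ‖F z‖ₑ ^ 2 with hX
  have hXtop : X ≠ ∞ := by
    intro h
    have := hF.2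
    rw [bergmanNorm, ← hX, h, ENNReal.top_div_of_ne_top ENNReal.ofReal_ne_top,
      ENNReal.top_rpow_of_pos (by norm_num)] at this
    exact lt_irrefl _ this
  set R := η / 2 with hR
  have hR0 : 0 < R := by positivity
  set D : ℝ≥0∞ := ENNReal.ofReal (R ^ α) * (ENNReal.ofReal (R / 2) *
    ENNReal.ofReal (2 * Real.pi) * ENNReal.ofReal (R / 2)) with hD
  have hD0 : D ≠ 0 := by
    have h1 : 0 < R ^ α := by positivity
    have h2 : 0 < R / 2 := by positivity
    simp [hD, h1, hR0, Real.pi_pos]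
  have hDtop : D ≠ ∞ := by finiteness
  have hbound : ∀ z : ℂ, η ≤ z.re → ‖F z‖ₑ ^ 2 ≤ X / D := by
    intro z hz
    have hball : ∀ w ∈ Metric.ball z R, R ≤ w.re := by
      intro w hw
      have h1 : |w.re - z.re| < R := by
        rw [← Complex.sub_re]
        exact (Complex.abs_re_le_norm _).trans_lt (by simpa [dist_eq_norm] using hw)
      linarith [(abs_lt.1 h1).1]
    have hsub : Metric.ball z R ⊆ rightHalfPlane := fun w hw => hR0.trans_le (hball w hw)
    rw [ENNReal.le_div_iff_mul_le (Or.inl hD0) (Or.inl hDtop)]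
    calc ‖F z‖ₑ ^ 2 * D = ENNReal.ofReal (R ^ α) * (ENNReal.ofReal (R / 2) *
          (ENNReal.ofReal (2 * Real.pi) * ‖F z‖ₑ ^ 2) * ENNReal.ofReal (R / 2)) := by
          rw [hD]; ring
      _ ≤ ENNReal.ofReal (R ^ α) * ∫⁻ w in Metric.ball z R, ‖F w‖ₑ ^ 2 := by
          gcongr
          exact mul_enorm_sq_le_setLIntegral_ball hR0 (hF.1.mono hsub)
      _ = ∫⁻ w in Metric.ball z R, ENNReal.ofReal (R ^ α) * ‖F w‖ₑ ^ 2 :=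
          (lintegral_const_mul' _ _ ENNReal.ofReal_ne_top).symm
      _ ≤ ∫⁻ w in Metric.ball z R, ENNReal.ofReal (w.re ^ α) * ‖F w‖ₑ ^ 2 := by
          refine setLIntegral_mono' Metric.isOpen_ball.measurableSet fun w hw => ?_
          gcongr
          exact hball w hw
      _ ≤ X := lintegral_mono_set hsub
  refine ⟨Real.sqrt (X / D).toReal, fun z hz => Real.le_sqrt_of_sq_le ?_⟩
  have h := ENNReal.toReal_mono (ENNReal.div_ne_top hXtop hD0) (hbound z hz)
  simpa using h

/-- For `α ≥ 0` the weight `(re z)^α` increases under translation to the right. -/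
theorem bergmanNorm_comp_add_le {α : ℝ} (hα : 0 ≤ α) (F : ℂ → ℂ) {η : ℝ} (hη : 0 ≤ η) :
    bergmanNorm α (fun z => F (z + η)) ≤ bergmanNorm α F := by
  unfold bergmanNorm
  refine ENNReal.rpow_le_rpow (ENNReal.div_le_div_right ?_ _) (by norm_num)
  rw [← lintegral_indicator measurableSet_rightHalfPlane,
    ← lintegral_indicator measurableSet_rightHalfPlane,
    ← lintegral_add_right_eq_self (rightHalfPlane.indicator
      fun z => ENNReal.ofReal (z.re ^ α) * ‖F z‖ₑ ^ 2) (η : ℂ)]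
  refine lintegral_mono fun z => ?_
  by_cases hz : z ∈ rightHalfPlane
  · have hz' : 0 < z.re := hz
    have hzη : z + η ∈ rightHalfPlane := by
      change 0 < (z + η).re
      simp
      linarith
    rw [indicator_of_mem hz, indicator_of_mem hzη]
    gcongr ENNReal.ofReal (?_ ^ α) * _
    simpa using hη
  · rw [indicator_of_notMem hz]
    exact zero_le

theorem bergmanNorm_le_of_tendsto {α : ℝ} {G : ℂ → ℂ} {Gs : ℕ → ℂ → ℂ}
    (hc : ∀ n, ContinuousOn (Gs n) rightHalfPlane)
    (hlim : ∀ z ∈ rightHalfPlane, Tendsto (fun n => Gs n z) atTop (𝓝 (G z))) {B : ℝ≥0∞}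
    (hB : ∀ n, bergmanNorm α (Gs n) ≤ B) : bergmanNorm α G ≤ B := by
  have hpi0 : ENNReal.ofReal Real.pi ≠ 0 := by simp [Real.pi_pos]
  have hiff : ∀ H : ℂ → ℂ, bergmanNorm α H ≤ B ↔
      ∫⁻ z in rightHalfPlane, ENNReal.ofReal (z.re ^ α) * ‖H z‖ₑ ^ 2 ≤
        B ^ (2 : ℝ) * ENNReal.ofReal Real.pi := by
    intro H
    rw [bergmanNorm, ← ENNReal.div_le_iff hpi0 ENNReal.ofReal_ne_top,
      show (1 / 2 : ℝ) = (2 : ℝ)⁻¹ by norm_num, ENNReal.rpow_inv_le_iff (by norm_num)]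
  rw [hiff]
  calc ∫⁻ z in rightHalfPlane, ENNReal.ofReal (z.re ^ α) * ‖G z‖ₑ ^ 2
      = ∫⁻ z in rightHalfPlane, liminf (fun n => ENNReal.ofReal (z.re ^ α) * ‖Gs n z‖ₑ ^ 2)
          atTop := by
        refine setLIntegral_congr_fun measurableSet_rightHalfPlane fun z hz => ?_
        refine (Tendsto.liminf_eq ?_).symm
        exact ENNReal.Tendsto.const_mul
          (((ENNReal.continuous_pow 2).tendsto _).comp (hlim z hz).enorm)
          (Or.inr ENNReal.ofReal_ne_top)
    _ ≤ liminf (fun n => ∫⁻ z in rightHalfPlane, ENNReal.ofReal (z.re ^ α) * ‖Gs n z‖ₑ ^ 2)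
          atTop := by
        refine lintegral_liminf_le' fun n => ?_
        have hre : Measurable fun z : ℂ => ENNReal.ofReal (z.re ^ α) := by fun_prop
        exact hre.aemeasurable.mul
          (((hc n).aestronglyMeasurable measurableSet_rightHalfPlane).enorm.pow_const 2)
    _ ≤ _ := by
        refine liminf_le_of_le ⟨0, by simp⟩ fun b hb => ?_
        obtain ⟨n, hn⟩ := hb.exists
        exact hn.trans ((hiff _).1 (hB n))

/-- A multiplier bounded by one on `ℂ₊`, lying in every `A²_ν`, that tends to `1` as `N → ∞`. -/
noncomputable def cutoff (N : ℝ) (z : ℂ) : ℂ := Complex.exp (-z * (N⁻¹ : ℝ)) * (N / (z + N))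

theorem add_ofReal_ne_zero {N : ℝ} (hN : 0 < N) {z : ℂ} (hz : z ∈ rightHalfPlane) :
    z + N ≠ 0 := by
  have := add_conj_ne_zero (v := N) (show 0 < z.re from hz) (by simpa using hN)
  simpa using this

theorem norm_cutoff_le_one {N : ℝ} (hN : 0 < N) {z : ℂ} (hz : z ∈ rightHalfPlane) :
    ‖cutoff N z‖ ≤ 1 := by
  have hz0 : 0 < z.re := hz
  rw [cutoff, norm_mul, Complex.norm_exp]
  refine mul_le_one₀ (Real.exp_le_one_iff.2 ?_) (norm_nonneg _) ?_
  · have : (-z * ((N⁻¹ : ℝ) : ℂ)).re = -(z.re * N⁻¹) := by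
      rw [Complex.re_mul_ofReal]; simp
    rw [this]
    have : 0 < z.re * N⁻¹ := by positivity
    linarith
  · rw [norm_div, div_le_one (norm_pos_iff.2 (add_ofReal_ne_zero hN hz)), Complex.norm_real,
      Real.norm_of_nonneg hN.le]
    refine le_trans ?_ (Complex.re_le_norm _)
    simp
    linarith

theorem differentiableOn_cutoff {N : ℝ} (hN : 0 < N) :
    DifferentiableOn ℂ (cutoff N) rightHalfPlane := by
  unfold cutoff
  refine DifferentiableOn.mul (by fun_prop) (DifferentiableOn.div (by fun_prop) (by fun_prop) ?_)
  exact fun z hz => add_ofReal_ne_zero hN hz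

theorem tendsto_cutoff {z : ℂ} (hz : z ∈ rightHalfPlane) :
    Tendsto (fun n : ℕ => cutoff ((n : ℝ) + 1) z) atTop (𝓝 1) := by
  have h0 : Tendsto (fun n : ℕ => ((((n : ℝ) + 1)⁻¹ : ℝ) : ℂ)) atTop (𝓝 ((0 : ℝ) : ℂ)) := by
    have := tendsto_one_div_add_atTop_nhds_zero_nat (𝕜 := ℝ)
    simp only [one_div] at this
    exact (Complex.continuous_ofReal.tendsto _).comp this
  have h1 : Tendsto (fun n : ℕ => Complex.exp (-z * ((((n : ℝ) + 1)⁻¹ : ℝ) : ℂ))) atTop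
      (𝓝 (Complex.exp (-z * ((0 : ℝ) : ℂ)))) :=
    (Complex.continuous_exp.tendsto _).comp (h0.const_mul _)
  have h2 : Tendsto (fun n : ℕ => (z * ((((n : ℝ) + 1)⁻¹ : ℝ) : ℂ) + 1)⁻¹) atTop
      (𝓝 (z * ((0 : ℝ) : ℂ) + 1)⁻¹) :=
    ((h0.const_mul z).add_const 1).inv₀ (by simp)
  have h3 := h1.mul h2
  simp only [Complex.ofReal_zero, mul_zero, Complex.exp_zero, zero_add, inv_one, mul_one] at h3
  refine h3.congr fun n => ?_
  have hn : (((n : ℝ) + 1 : ℝ) : ℂ) ≠ 0 := by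
    have : (n : ℝ) + 1 ≠ 0 := by positivity
    exact_mod_cast this
  have hzn := add_ofReal_ne_zero (N := (n : ℝ) + 1) (by positivity) hz
  rw [cutoff]
  congr 1
  rw [Complex.ofReal_inv, ← div_eq_mul_inv, div_add_one hn, inv_div]

/-- `N/(z+N)` is the transform of `N e^{-Nt}`, and the exponential factor delays this density by
`1/N`, away from a possible singularity of the weight at `0`. Beyond `1/N` the weight is bounded. -/
theorem zenNorm_cutoff_lt_top {ν : Measure ℝ≥0} [SFinite ν]
    (htop : ∀ t, 0 < t → weight ν t ≠ ∞) {N : ℝ} (hN : 0 < N) : zenNorm ν (cutoff N) < ∞ := by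
  set k : ℝ → ℂ := fun t => N * Complex.exp (-(N : ℂ) * t) with hk
  have hk2 : ∫⁻ t in Ioi (0 : ℝ), ‖k t‖ₑ ^ 2 < ∞ := by
    have : ∀ t, ‖k t‖ₑ ^ 2 = ENNReal.ofReal (N ^ 2 * Real.exp (-(2 * N) * t)) := by
      intro t
      rw [← ofReal_norm, ← ENNReal.ofReal_pow (norm_nonneg _), hk, norm_mul, mul_pow,
        Complex.norm_exp, ← Real.exp_nat_mul, Complex.norm_real, Real.norm_of_nonneg hN.le]
      congr 3
      simp
      ring
    simp_rw [this]
    exact ((integrableOn_exp_mul_Ioi (by linarith) 0).const_mul _).lintegral_lt_top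
  have hkE : ExpSqIntegrable k := by
    refine ⟨Continuous.aestronglyMeasurable (by fun_prop), fun x hx => ?_⟩
    refine lt_of_le_of_lt (setLIntegral_mono' measurableSet_Ioi fun t ht => ?_) hk2
    have ht : 0 < t := ht
    refine mul_le_of_le_one_left' (ENNReal.ofReal_le_one.2 (Real.exp_le_one_iff.2 ?_))
    nlinarith [mul_pos hx ht]
  have hη : 0 < N⁻¹ := by positivity
  have heq : EqOn (cutoff N) (laplace (delay N⁻¹ k)) rightHalfPlane := by
    intro z hz
    rw [laplace_delay hη.le, cutoff, laplace]
    congr 1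
    have hre : (-(z + N)).re < 0 := by
      have : 0 < z.re := hz
      simp
      linarith
    have := integral_exp_mul_complex_Ioi hre 0
    rw [Complex.ofReal_zero, mul_zero, Complex.exp_zero, neg_div_neg_eq] at this
    rw [div_eq_mul_one_div, ← this, ← integral_const_mul]
    refine integral_congr_ae (Eventually.of_forall fun t => ?_)
    simp only [hk]
    rw [mul_left_comm, ← Complex.exp_add]
    ring_nf
  rw [zenNorm_congr ν heq, zenNorm_laplace ν (hkE.delay hη.le)]
  refine ENNReal.rpow_lt_top_of_nonneg (by norm_num) (ne_of_lt ?_)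
  simp_rw [mul_comm _ (weight ν _)]
  rw [lintegral_mul_delay hη.le]
  refine lt_of_le_of_lt (setLIntegral_mono' measurableSet_Ioi fun t ht => ?_)
    (b := ∫⁻ t in Ioi (0 : ℝ), weight ν N⁻¹ * ‖k t‖ₑ ^ 2) ?_
  · have ht : 0 < t := ht
    gcongr
    exact weight_antitone ν (by linarith)
  · rw [lintegral_const_mul' _ _ (htop _ hη)]
    exact ENNReal.mul_lt_top (htop _ hη).lt_top hk2

/-- The approximants `F(z + 1/N) · cutoff` of a function in `B²_α` belong to `A²_ν`. -/
theorem memSpace_zenNorm_cutoff_mul {ν : Measure ℝ≥0} [SFinite ν]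
    (htop : ∀ t, 0 < t → weight ν t ≠ ∞) {α : ℝ} (hα : 0 ≤ α) {F : ℂ → ℂ}
    (hF : MemSpace (bergmanNorm α) F) {N : ℝ} (hN : 0 < N) :
    MemSpace (zenNorm ν) fun z => cutoff N z * F (z + (N⁻¹ : ℝ)) := by
  have hη : 0 < N⁻¹ := by positivity
  obtain ⟨B, hB⟩ := exists_norm_le_of_bergmanNorm_lt_top hα hF hη
  have hmap : MapsTo (fun z : ℂ => z + (N⁻¹ : ℝ)) rightHalfPlane rightHalfPlane := by
    intro z hz
    have : 0 < z.re := hz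
    change 0 < (z + (N⁻¹ : ℝ)).re
    rw [Complex.add_re, Complex.ofReal_re]
    positivity
  refine ⟨(differentiableOn_cutoff hN).mul (hF.1.comp (by fun_prop) hmap), ?_⟩
  have hBnn : 0 ≤ B := (norm_nonneg _).trans (hB ((N⁻¹ : ℝ) : ℂ) (by simp))
  refine lt_of_le_of_lt (b := ENNReal.ofReal B * zenNorm ν (cutoff N)) ?_
    (ENNReal.mul_lt_top ENNReal.ofReal_lt_top (zenNorm_cutoff_lt_top htop hN))
  have h1 : zenNorm ν (fun z => cutoff N z * F (z + (N⁻¹ : ℝ))) ≤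
      zenNorm ν (fun z => (B : ℂ) * cutoff N z) := by
    refine zenNorm_mono ν fun z hz => ?_
    have hz0 : 0 < z.re := hz
    rw [norm_mul, norm_mul, mul_comm, Complex.norm_real, Real.norm_of_nonneg hBnn]
    gcongr
    refine hB _ ?_
    rw [Complex.add_re, Complex.ofReal_re]
    linarith
  refine h1.trans (le_of_eq ?_)
  unfold zenNorm
  have h2 : ENNReal.ofReal B = (ENNReal.ofReal B ^ 2) ^ (1 / 2 : ℝ) := by
    rw [← ENNReal.rpow_natCast, ← ENNReal.rpow_mul]
    norm_num
  rw [h2, ← ENNReal.mul_rpow_of_nonneg _ _ (by norm_num), ENNReal.mul_iSup]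
  congr 1
  refine iSup_congr fun ε => ?_
  rw [ENNReal.mul_iSup]
  refine iSup_congr fun hε => ?_
  rw [← lintegral_const_mul' _ _ (by finiteness)]
  refine lintegral_congr fun p => ?_
  rw [enorm_mul, mul_pow, ← ofReal_norm (B : ℂ), Complex.norm_real, Real.norm_of_nonneg hBnn]

theorem le_opNorm_mul {N : (ℂ → ℂ) → ℝ≥0∞} {T : (ℂ → ℂ) → ℂ → ℂ} (hT : IsBoundedOn N T)
    {F : ℂ → ℂ} (hF : MemSpace N F) : N (T F) ≤ opNorm N T * N F := by
  obtain ⟨C, hC⟩ := hT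
  -- Dividing by `N F` requires it to be nonzero; if it vanishes, a finite bound `C` forces the
  -- image to have norm `0`.
  by_cases h0 : N F = 0
  · have := (hC F hF).2
    rw [h0, mul_zero] at this
    exact this.trans zero_le
  · rw [← ENNReal.div_le_iff h0 hF.2.ne]
    exact le_sInf fun K hK => (ENNReal.div_le_iff h0 hF.2.ne).2 (hK F hF)

theorem opNorm_lt_top {N : (ℂ → ℂ) → ℝ≥0∞} {T : (ℂ → ℂ) → ℂ → ℂ} (hT : IsBoundedOn N T) :
    opNorm N T < ∞ := by
  obtain ⟨C, hC⟩ := hT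
  refine lt_of_le_of_lt (b := (C : ℝ≥0∞)) (sInf_le ?_) ENNReal.coe_lt_top
  exact fun F hF => (hC F hF).2

/-- A bound on `A²_ν` for the `B²_α`-norm extends to all of `B²_α`. -/
theorem bergmanNorm_weightedComp_le {ν : Measure ℝ≥0} [SFinite ν]
    (htop : ∀ t, 0 < t → weight ν t ≠ ∞) {α : ℝ} (hα : 0 ≤ α) {h φ : ℂ → ℂ}
    (hh : DifferentiableOn ℂ h rightHalfPlane) (hφ : DifferentiableOn ℂ φ rightHalfPlane)
    (hmaps : MapsTo φ rightHalfPlane rightHalfPlane) {K : ℝ≥0∞}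
    (hK : ∀ F, MemSpace (zenNorm ν) F →
      bergmanNorm α (weightedComp h φ F) ≤ K * bergmanNorm α F)
    {F : ℂ → ℂ} (hF : MemSpace (bergmanNorm α) F) :
    bergmanNorm α (weightedComp h φ F) ≤ K * bergmanNorm α F := by
  set Fs : ℕ → ℂ → ℂ := fun n z => cutoff ((n : ℝ) + 1) z * F (z + (((n : ℝ) + 1)⁻¹ : ℝ)) with hFs
  have hN : ∀ n : ℕ, (0 : ℝ) < (n : ℝ) + 1 := fun n => by positivity
  have hmem : ∀ n, MemSpace (zenNorm ν) (Fs n) := fun n =>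
    memSpace_zenNorm_cutoff_mul htop hα hF (hN n)
  have hlim : ∀ z ∈ rightHalfPlane, Tendsto (fun n => Fs n z) atTop (𝓝 (F z)) := by
    intro z hz
    have h0 : Tendsto (fun n : ℕ => z + ((((n : ℝ) + 1)⁻¹ : ℝ) : ℂ)) atTop
        (𝓝 (z + ((0 : ℝ) : ℂ))) := by
      have := tendsto_one_div_add_atTop_nhds_zero_nat (𝕜 := ℝ)
      simp only [one_div] at this
      exact ((Complex.continuous_ofReal.tendsto _).comp this).const_add z
    rw [Complex.ofReal_zero, add_zero] at h0
    have hcont : ContinuousAt F z :=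
      (hF.1.differentiableAt (isOpen_rightHalfPlane.mem_nhds hz)).continuousAt
    have := (tendsto_cutoff hz).mul (hcont.tendsto.comp h0)
    rwa [one_mul] at this
  refine bergmanNorm_le_of_tendsto (Gs := fun n => weightedComp h φ (Fs n))
    (fun n => (hh.mul ((hmem n).1.comp hφ hmaps)).continuousOn)
    (fun z hz => (hlim _ (hmaps hz)).const_mul _) fun n => ?_
  refine (hK _ (hmem n)).trans (mul_le_mul_right ?_ _)
  refine (bergmanNorm_mono α fun z hz => ?_).trans
    (bergmanNorm_comp_add_le hα F (η := ((n : ℝ) + 1)⁻¹) (by positivity))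
  rw [hFs, norm_mul]
  exact mul_le_of_le_one_left (norm_nonneg _) (norm_cutoff_le_one (hN n) hz)

end ZenSpace

theorem mainTheorem6
    (ν : Measure ℝ≥0) [ν.Regular] (hν : ν ≠ 0) (hΔ : ZenSpace.DeltaTwo ν)
    (hL : ZenSpace.LaplaceSurjective ν)
    (h φ : ℂ → ℂ)
    (hh : DifferentiableOn ℂ h ZenSpace.rightHalfPlane)
    (hφ : DifferentiableOn ℂ φ ZenSpace.rightHalfPlane)
    (hφ_maps : MapsTo φ ZenSpace.rightHalfPlane ZenSpace.rightHalfPlane)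
    -- `c` is the coefficient of the linear term in the Nevanlinna representation of `φ`
    (c : ℝ) (hc : Tendsto (fun x : ℝ => φ (x : ℂ) / (x : ℂ)) atTop (𝓝 (c : ℂ)))
    (a : ℝ) (ha : 0 < a) (hac : a ≤ c)
    (hW : ZenSpace.IsBoundedOn (ZenSpace.zenNorm ν) (ZenSpace.weightedComp h φ)) :
    ∃ α' : ℝ, 0 < α' ∧ ∀ α : ℝ, α' ≤ α →
      ZenSpace.IsBoundedOn (ZenSpace.bergmanNorm α) (ZenSpace.weightedComp h φ) ∧
      ZenSpace.opNorm (ZenSpace.bergmanNorm α) (ZenSpace.weightedComp h φ) ≤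
        ENNReal.ofReal (a ^ (-(α + 1) / 2)) *
          (⨆ (t : ℝ) (_ : 0 < t),
            ZenSpace.weight ν (t / a) / ZenSpace.weight ν t) ^ (1 / 2 : ℝ) *
          ZenSpace.opNorm (ZenSpace.zenNorm ν) (ZenSpace.weightedComp h φ) ∧
      ENNReal.ofReal (a ^ (-(α + 1) / 2)) *
          (⨆ (t : ℝ) (_ : 0 < t),
            ZenSpace.weight ν (t / a) / ZenSpace.weight ν t) ^ (1 / 2 : ℝ) *
          ZenSpace.opNorm (ZenSpace.zenNorm ν) (ZenSpace.weightedComp h φ) < ∞ := by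
  obtain ⟨C, hC1, hpc⟩ := ZenSpace.exists_deltaTwo_const hν hΔ
  have hpos : ∀ r : ℝ≥0, 0 < r → 0 < ν (Iio r) := fun r hr => (hpc r hr).1
  have hC : ∀ r : ℝ≥0, 0 < r → ν (Iio (2 * r)) ≤ C * ν (Iio r) := fun r hr => (hpc r hr).2
  have htop : ∀ t, 0 < t → ZenSpace.weight ν t ≠ ∞ := fun t ht =>
    (ZenSpace.weight_lt_top hC ht).ne
  have h0 : ∀ t, 0 < t → ZenSpace.weight ν t ≠ 0 := fun t ht => by
    refine (lt_of_lt_of_le ?_ (ZenSpace.ofReal_exp_mul_measure_le_weight ν 1 ht)).ne'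
    exact ENNReal.mul_pos (by simp [Real.pi_pos, Real.exp_pos]) (hpos 1 one_pos).ne'
  have hre : ∀ z ∈ ZenSpace.rightHalfPlane, a * z.re ≤ (φ z).re := fun z hz =>
    (mul_le_mul_of_nonneg_right hac (le_of_lt hz)).trans
      (ZenSpace.mul_re_le_re_of_tendsto hφ hφ_maps (ha.trans_le hac) hc hz)
  have hM := fun F hF => And.intro (hW.choose_spec F hF).1 (ZenSpace.le_opNorm_mul hW hF)
  have hMtop := ZenSpace.opNorm_lt_top hW
  -- Monotonicity of the weight quotient needs `α + 1 ≥ C²` and the approximation needs `α ≥ 0`;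
  -- this threshold ensures both.
  refine ⟨(C : ℝ) ^ 2 + 1, by positivity, fun α hα => ?_⟩
  have hα0 : 0 ≤ α := le_trans (by positivity) hα
  set K := ENNReal.ofReal (a ^ (-(α + 1) / 2)) *
    (⨆ (t : ℝ) (_ : 0 < t), ZenSpace.weight ν (t / a) / ZenSpace.weight ν t) ^ (1 / 2 : ℝ) *
    ZenSpace.opNorm (ZenSpace.zenNorm ν) (ZenSpace.weightedComp h φ) with hKdef
  have hKtop : K < ∞ := ENNReal.mul_lt_top (ENNReal.mul_lt_top ENNReal.ofReal_lt_top
    (ENNReal.rpow_lt_top_of_nonneg (by norm_num)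
      (ZenSpace.iSup_weight_div_lt_top hC ha).ne)) hMtop
  have hK : ∀ F, ZenSpace.MemSpace (ZenSpace.bergmanNorm α) F →
      ZenSpace.bergmanNorm α (ZenSpace.weightedComp h φ F) ≤ K * ZenSpace.bergmanNorm α F :=
    fun F hF => ZenSpace.bergmanNorm_weightedComp_le htop hα0 hh hφ hφ_maps
      (fun G hG => ZenSpace.bergmanNorm_weightedComp_laplace_le hpos hC hL h0 htop hφ hφ_maps ha
        hre hMtop.ne hM (by linarith)
        (fun s t hs hst => ZenSpace.weight_le_rpow_mul_weight hC1 hC (by linarith) hs hst) hG) hF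
  refine ⟨⟨K.toNNReal, fun F hF => ?_⟩, sInf_le hK, hKtop⟩
  rw [ENNReal.coe_toNNReal hKtop.ne]
  exact ⟨⟨hh.mul (hF.1.comp hφ hφ_maps), (hK F hF).trans_lt (ENNReal.mul_lt_top hKtop hF.2)⟩,
    hK F hF⟩
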